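/- Let $M,N\ge 0$ be integers, let $V=\mathbb C^{M|N}$ have the homogeneous basis $e_1,\dots,e_{M+N}$ with $|e_i|=|i|=0$ for $i\le M$ and $|i|=1$ for $i>M$, and let $E_{ij}e_k=\delta_{jk}e_i$. Tensor products of superalgebras carry the sign rule $(a\otimes b)(a'\otimes b')=(-1)^{|b||a'|}aa'\otimes bb'$, and $X_a$ denotes $X=\sum_{i,j}E_{ij}\otimes X_{ij}$ with $E_{ij}$ in the $a$-th tensor factor. Let $P=\sum_{i,j}(-1)^{|j|}E_{ij}\otimes E_{ji}$ and $R(u)=1-u^{-1}P$. The super Yangian $\mathrm Y=\mathrm Y(\mathfrak{gl}_{M|N})$ is the complex superalgebra with generators $t_{ij}^{(r)}$ ($1\le i,j\le M+N$, $r\ge1$) of parity $|i|+|j|$ and relations $$R_{12}(u-v)T_1(u)T_2(v)=T_2(v)T_1(u)R_{12}(u-v),\qquad T(u)=\sum_{i,j}E_{ij}\otimes t_{ij}(u),\quad t_{ij}(u)=\delta_{ij}+\sum_{r\ge1}t_{ij}^{(r)}u^{-r}.$$ Write $T(u)^{-1}=\sum_{i,j} E_{ij}\otimes\tilde t_{ij}(u)$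 and $T^*(u)=\sum_{i,j} E_{ij}\otimes t^*_{ij}(u)$ with $t^*_{ij}(u)=(-1)^{|i||j|+|j|}\,\tilde t_{ji}(u)$. The quantum Berezinian is $$\mathfrak B_{M|N}(u)=\sum_{\sigma\in\mathfrak S_M}\operatorname{sgn}\sigma\; t_{\sigma(1),1}(u+M-N-1)\cdots t_{\sigma(M),M}(u-N)\;\times\;\sum_{\sigma\in\mathfrak S_N}\operatorname{sgn}\sigma\;\tilde t_{M+1,M+\sigma(1)}(u-N)\cdots\tilde t_{M+N,M+\sigma(N)}(u-1),$$ where all series are expanded in $u^{-1}$. Let $\pi_m:\mathfrak S_m\to(\operatorname{End}V)^{\otimes m}$ be the homomorphism that sends the transposition $(a\,b)$ to $P_{ab}$ for $a<b$; let $G^{(M)}=\sum_{\sigma\in\mathfrak S_M}\operatorname{sgn}(\sigma)\,\pi_M(\sigma)$, $H^{(N)}=\sum_{\sigma\in\mathfrak S_N}\pi_N(\sigma)$ and $A^{(M|N)}=G^{(M)}\otimes H^{(N)}$. Let $\mathcal I$ and $\mathcal J$ be the projections of $V$ onto its even and odd parts and let $\Im=\mathcal I_1\cdots\mathcal I_M\mathcal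 J_{M+1}\cdots\mathcal J_{M+N}$. Put $w_i=u+M-N-i$ for $i\le M$, $w_i=u-M-N-1+i$ for $i>M$, and $$\mathbb T(u)=T_1(w_1)\cdots T_M(w_M)\,T^*_{M+1}(w_{M+1})\cdots T^*_{M+N}(w_{M+N})\in\operatorname{End}V^{\otimes(M+N)}\otimes\mathrm Y[[u^{-1}]].$$ Theorem. 1. The operator $\mathcal E=\frac1{M!\,N!}\,\Im A^{(M|N)}$ on $V^{\otimes(M+N)}$ is idempotent, and the image of $A^{(M|N)}\Im$ is one-dimensional. 2. There is exactly one series $\mathfrak D(u)\in\mathrm Y[[u^{-1}]]$ with $$\Im A^{(M|N)}\,\mathfrak D(u)\,\Im=\Im A^{(M|N)}\,\mathbb T(u)\,\Im\quad\text{in }\operatorname{End}V^{\otimes(M+N)}\otimes\mathrm Y[[u^{-1}]],$$ namely $\mathfrak D(u)=\mathfrak B_{M|N}(u)$, and it lies in $1+u^{-1}\mathrm Y[[u^{-1}]]$. 3. With $\operatorname{Str}_{1,\dots,M+N}$ the full supertrace over $\operatorname{End}V^{\otimes(M+N)}$, $$\mathfrak B_{M|N}(u)=(-1)^N\operatorname{Str}_{1,\dots,M+N}\,\mathcal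 E\,\mathbb T(u)=(-1)^N\operatorname{Str}_{1,\dots,M+N}\,\mathcal E\,\mathbb T(u)\,\Im .$$ (For even $N$ the sign is $1$.) -/

import Mathlib

/-!
At spectral parameters that differ by one, `R(u - v)` becomes `1 ∓ P`, and the RTT relation says
that for the even indices the `2 × 2` minors of `T(w_a)`, `T(w_{a+1})` are antisymmetric in their
columns; the relation for `T⁻¹` gives the same for `T*` and the odd indices. A product of sums over
permutations built from such consecutive factors is therefore alternating in the columns, exactly
like a determinant.

On the tensors with even vectors in the first `M` places and odd vectors in the last `N` places, `P`
acts on the odd places as minus the flip, so that both `G^{(M)}` and `H^{(N)}` act as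
antisymmetrizers. Hence `ℑA = v vᵀ` for a single vector `v` of signs with `vᵀ v = M! N!`, and the
alternating property reads `vᵀ 𝕋(u) ℑ = 𝔅(u) vᵀ`. The fusion identity is `v` times this equation,
one entry of it determines the series, and its diagonal gives the supertraces: on every diagonal
entry where `v` does not vanish the parity of the tensor is that of `N`.
-/

open scoped PowerSeries

namespace SuperYangian

/-! ## Signs and superalgebras -/

/-- The sign `(-1)^p` of a parity `p`. -/
def ksign (p : ZMod 2) : ℤ := if p = 0 then 1 else -1

theorem ksign_zero : ksign 0 = 1 := by decide

theorem ksign_add : ∀ p q : ZMod 2, ksign (p + q) = ksign p * ksign q := by decide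

theorem ksign_mul_self : ∀ p : ZMod 2, ksign p * ksign p = 1 := by decide

/-- A complex associative superalgebra. The grading is recorded by its parity automorphism
`a ↦ (-1)^|a| a`: the even (odd) part is the eigenspace for the eigenvalue `1` (`-1`). -/
class Superalgebra (A : Type*) [Ring A] [Algebra ℂ A] where
  parity : A →ₐ[ℂ] A
  parity_parity : ∀ a, parity (parity a) = a

section Parity

variable {A : Type*} [Ring A] [Algebra ℂ A] [Superalgebra A]

/-- `parityPow p a = (-1)^(p * |a|) a` for homogeneous `a`. -/
def parityPow (p : ZMod 2) : A →ₐ[ℂ] A :=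
  if p = 0 then AlgHom.id ℂ A else Superalgebra.parity

theorem parityPow_zero (a : A) : parityPow 0 a = a := by simp [parityPow]

theorem parityPow_add (p q : ZMod 2) (a : A) :
    parityPow (p + q) a = parityPow p (parityPow q a) := by
  have h : ∀ p : ZMod 2, p = 0 ∨ p = 1 := by decide
  rcases h p with rfl | rfl <;> rcases h q with rfl | rfl
  · simp [parityPow]
  · simp [parityPow]
  · simp [parityPow]
  · have : (1 + 1 : ZMod 2) = 0 := by decide
    simp [parityPow, this, Superalgebra.parity_parity]

/-- The coefficientwise superalgebra structure on formal power series
(the variable is even). -/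
noncomputable instance : Superalgebra A⟦X⟧ where
  parity := PowerSeries.mapAlgHom Superalgebra.parity
  parity_parity a := by
    ext n
    simp [PowerSeries.mapAlgHom_apply, Superalgebra.parity_parity]

end Parity

/-! ## The superalgebra `End W ⊗ A` -/

/-- `End W ⊗ A` for a superspace `W` with a homogeneous basis indexed by `ι`, of parities `p`.
The matrix `(X i j)` stands for `∑ E i j ⊗ X i j`, where `E i j` is the operator
`e k ↦ δ j k • e i`. -/
def SuperMat {ι : Type*} (_ : ι → ZMod 2) (A : Type*) : Type _ := Matrix ι ι A

namespace SuperMat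

variable {ι : Type*} [Fintype ι] [DecidableEq ι] {p : ι → ZMod 2}
variable {A : Type*} [Ring A]

/-- The element `∑ E i j ⊗ X i j` given by a matrix. -/
def of (X : Matrix ι ι A) : SuperMat p A := X

instance : AddCommGroup (SuperMat p A) := inferInstanceAs (AddCommGroup (Matrix ι ι A))

/-- The element `1 ⊗ a`. -/
def ofCoeff (a : A) : SuperMat p A := fun i j => if i = j then a else 0

instance : One (SuperMat p A) := ⟨ofCoeff 1⟩

variable [Algebra ℂ A]

/-- The element `x ⊗ 1`. -/
def ofOp (x : Matrix ι ι ℂ) : SuperMat p A := fun i j => algebraMap ℂ A (x i j)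

variable [Superalgebra A]

/-- The product of the tensor product of superalgebras:
`(E i j ⊗ a) (E j k ⊗ b) = (-1)^(|a| |E j k|) E i k ⊗ a b`, with `|E j k| = |j| + |k|`. -/
instance : Mul (SuperMat p A) :=
  ⟨fun X Y i k => ∑ j, parityPow (p j + p k) (X i j) * Y j k⟩

theorem mul_apply (X Y : SuperMat p A) (i k : ι) :
    (X * Y) i k = ∑ j, parityPow (p j + p k) (X i j) * Y j k := rfl

theorem add_apply (X Y : SuperMat p A) (i k : ι) : (X + Y) i k = X i k + Y i k := rfl

theorem sub_apply (X Y : SuperMat p A) (i k : ι) : (X - Y) i k = X i k - Y i k := rfl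

theorem zero_apply (i k : ι) : (0 : SuperMat p A) i k = 0 := rfl

theorem one_apply (i k : ι) : (1 : SuperMat p A) i k = if i = k then 1 else 0 := rfl

theorem zmod_add_self (a : ZMod 2) : a + a = 0 := by revert a; decide

instance : Ring (SuperMat p A) :=
  { (inferInstance : AddCommGroup (SuperMat p A)), (inferInstance : One (SuperMat p A)),
    (inferInstance : Mul (SuperMat p A)) with
    mul_assoc := by
      intro X Y Z
      funext i l
      simp only [mul_apply, map_sum, map_mul, Finset.sum_mul, Finset.mul_sum]
      rw [Finset.sum_comm]
      refine Finset.sum_congr rfl fun j _ => Finset.sum_congr rfl fun k _ => ?_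
      rw [← parityPow_add, mul_assoc]
      have : p k + p l + (p j + p k) = p j + p l := by
        linear_combination zmod_add_self (p k)
      rw [this]
    one_mul := by
      intro X
      funext i k
      simp only [mul_apply, one_apply]
      rw [Finset.sum_eq_single i] <;> simp +contextual [eq_comm]
    mul_one := by
      intro X
      funext i k
      simp only [mul_apply, one_apply]
      rw [Finset.sum_eq_single k] <;> simp +contextual [zmod_add_self, parityPow_zero]
    left_distrib := by
      intro X Y Z
      funext i k
      simp only [mul_apply, add_apply, mul_add, Finset.sum_add_distrib]
    right_distrib := by
      intro X Y Z
      funext i k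
      simp only [mul_apply, add_apply, map_add, add_mul, Finset.sum_add_distrib]
    zero_mul := by
      intro X
      funext i k
      simp [mul_apply, zero_apply]
    mul_zero := by
      intro X
      funext i k
      simp [mul_apply, zero_apply] }

/-- The supertrace `End W ⊗ A → A`, `E i j ⊗ a ↦ (-1)^|i| δ i j a`. -/
def str (X : SuperMat p A) : A := ∑ i, ksign (p i) • X i i

/-- The graded transposition `(X^t) i j = (-1)^(|i| |j| + |j|) X j i`. -/
def transpose (X : SuperMat p A) : SuperMat p A :=
  fun i j => ksign (p i * p j + p j) • X j i

/-- The even elements: `|X i j| = |i| + |j|` for all `i`, `j`. -/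
def IsEven (X : SuperMat p A) : Prop :=
  ∀ i j, Superalgebra.parity (X i j) = ksign (p i + p j) • X i j

theorem IsEven.mul {X Y : SuperMat p A} (hX : X.IsEven) (hY : Y.IsEven) : (X * Y).IsEven := by
  intro i k
  simp only [mul_apply, map_sum, map_mul, Finset.smul_sum]
  refine Finset.sum_congr rfl fun j _ => ?_
  have h : Superalgebra.parity (parityPow (p j + p k) (X i j)) =
      ksign (p i + p j) • parityPow (p j + p k) (X i j) := by
    unfold parityPow
    split_ifs
    · simpa using hX i j
    · rw [hX i j, map_zsmul, hX i j]
  have e : p i + p k = (p i + p j) + (p j + p k) := by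
    linear_combination -zmod_add_self (p j)
  rw [h, hY j k, smul_mul_smul_comm, ← ksign_add, e]

theorem IsEven.sub {X Y : SuperMat p A} (hX : X.IsEven) (hY : Y.IsEven) : (X - Y).IsEven := by
  intro i k
  simp only [sub_apply, map_sub, hX i k, hY i k, smul_sub]

theorem isEven_ofOp {x : Matrix ι ι ℂ} (hx : ∀ i j, x i j ≠ 0 → p i = p j) :
    (ofOp x : SuperMat p A).IsEven := by
  intro i j
  simp only [ofOp, AlgHom.commutes]
  by_cases h : x i j = 0
  · simp [h]
  · rw [hx i j h, zmod_add_self, ksign_zero, one_smul]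

/-- A power series with coefficients in `End W ⊗ A`, as an element of `End W ⊗ A⟦X⟧`. -/
noncomputable def seriesFun (f : (SuperMat p A)⟦X⟧) : SuperMat p A⟦X⟧ :=
  fun i j => PowerSeries.mk fun n => PowerSeries.coeff n f i j

theorem coeff_seriesFun (f : (SuperMat p A)⟦X⟧) (i j : ι) (n : ℕ) :
    PowerSeries.coeff n (seriesFun f i j) = PowerSeries.coeff n f i j :=
  PowerSeries.coeff_mk _ _

theorem sum_apply' {κ : Type*} (s : Finset κ) (F : κ → SuperMat p A) (i j : ι) :
    (∑ x ∈ s, F x) i j = ∑ x ∈ s, F x i j :=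
  Matrix.sum_apply i j s F

theorem coeff_parityPow (q : ZMod 2) (f : A⟦X⟧) (n : ℕ) :
    PowerSeries.coeff n (parityPow q f) = parityPow q (PowerSeries.coeff n f) := by
  unfold parityPow
  split_ifs
  · rfl
  · change PowerSeries.coeff n (PowerSeries.mapAlgHom _ _) = _
    rw [PowerSeries.mapAlgHom_apply, PowerSeries.coeff_map]
    rfl

/-- `seriesFun` is a homomorphism of rings. -/
noncomputable def ofSeries : (SuperMat p A)⟦X⟧ →+* SuperMat p A⟦X⟧ where
  toFun := seriesFun
  map_one' := by
    funext i j
    ext n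
    rw [coeff_seriesFun, one_apply, PowerSeries.coeff_one]
    by_cases h : i = j <;> by_cases hn : n = 0 <;>
      simp [h, hn, one_apply, zero_apply, PowerSeries.coeff_one]
  map_mul' f g := by
    funext i j
    ext n
    rw [coeff_seriesFun, mul_apply, map_sum, PowerSeries.coeff_mul, sum_apply']
    simp only [mul_apply]
    rw [Finset.sum_comm]
    refine Finset.sum_congr rfl fun k _ => ?_
    rw [PowerSeries.coeff_mul]
    refine Finset.sum_congr rfl fun x _ => ?_
    rw [coeff_parityPow, coeff_seriesFun, coeff_seriesFun]
  map_zero' := by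
    funext i j
    ext n
    rw [coeff_seriesFun]
    simp [zero_apply]
  map_add' f g := by
    funext i j
    ext n
    rw [coeff_seriesFun, map_add, add_apply, add_apply, map_add, coeff_seriesFun,
      coeff_seriesFun]

end SuperMat

/-! ## Operators on tensor powers -/

section Tensor

variable {ι : Type*} [Fintype ι] [DecidableEq ι]

/-- The parity of the basis vector `e (K 0) ⊗ ⋯ ⊗ e (K (m-1))` of `V^{⊗ m}`. -/
def tpar (p : ι → ZMod 2) (m : ℕ) (K : Fin m → ι) : ZMod 2 := ∑ a, p (K a)

/-- The operator `1 ⊗ ⋯ ⊗ X ⊗ ⋯ ⊗ 1` on `V^{⊗ m}`, with `X` in the place `a`: by the sign rule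
`E i j` in the place `a` sends `e K` to
`(-1)^((|i| + |j|) ∑_{b < a} |K b|) δ j (K a) e K'`, where `K'` is `K` with `i` in the place `a`.
With entries in `A` it is the element `X_a` of `End V^{⊗ m} ⊗ A`. -/
def place (p : ι → ZMod 2) {R : Type*} [AddCommGroup R] {m : ℕ} (a : Fin m) (X : Matrix ι ι R) :
    Matrix (Fin m → ι) (Fin m → ι) R :=
  Matrix.of fun L K => if ∀ b, b ≠ a → L b = K b then
    ksign ((p (L a) + p (K a)) * ∑ b ∈ Finset.univ.filter (· < a), p (K b)) • X (L a) (K a)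
  else 0

/-- The operator `X ⊗ Y` on `V^{⊗ (m + n)}`, with the sign rule
`(X ⊗ Y) (v ⊗ w) = (-1)^(|Y| |v|) X v ⊗ Y w`. -/
def tensorOp (p : ι → ZMod 2) {m n : ℕ} (X : Matrix (Fin m → ι) (Fin m → ι) ℂ)
    (Y : Matrix (Fin n → ι) (Fin n → ι) ℂ) :
    Matrix (Fin (m + n) → ι) (Fin (m + n) → ι) ℂ :=
  Matrix.of fun L K =>
    ksign ((tpar p n (fun b => L (Fin.natAdd m b)) + tpar p n (fun b => K (Fin.natAdd m b))) *
        tpar p m (fun a => K (Fin.castAdd n a))) •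
      (X (fun a => L (Fin.castAdd n a)) (fun a => K (Fin.castAdd n a)) *
        Y (fun b => L (Fin.natAdd m b)) (fun b => K (Fin.natAdd m b)))

/-- The super-permutation operator `P_{ab} = ∑ (-1)^|j| (E i j)_a (E j i)_b`, for `a < b`. -/
def superP (p : ι → ZMod 2) {m : ℕ} (a b : Fin m) : Matrix (Fin m → ι) (Fin m → ι) ℂ :=
  ∑ i, ∑ j, ksign (p j) •
    (place p a (Matrix.single i j (1 : ℂ)) * place p b (Matrix.single j i (1 : ℂ)))

/-- The exponent of the sign that arises when `σ` permutes the factors of `e K`: one crossing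
`|K a| |K b|` for each inversion `a < b`, `σ b < σ a`. -/
def crossing (p : ι → ZMod 2) {m : ℕ} (σ : Equiv.Perm (Fin m)) (K : Fin m → ι) : ZMod 2 :=
  ∑ a, ∑ b, if a < b ∧ σ b < σ a then p (K a) * p (K b) else 0

theorem sum_pairs {m : ℕ} (f : Fin m → Fin m → ZMod 2) (hf : ∀ a, f a a = 0) :
    ∑ a, ∑ b, f a b = ∑ a, ∑ b, if a < b then f a b + f b a else 0 := by
  have h1 : ∀ a b, f a b = (if a < b then f a b else 0) + (if b < a then f a b else 0) := by
    intro a b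
    rcases lt_trichotomy a b with h | h | h
    · simp [h, h.not_gt]
    · subst h; simp [hf]
    · simp [h, h.not_gt]
  have h2 : ∑ a, ∑ b, (if b < a then f a b else 0) = ∑ a, ∑ b, if a < b then f b a else 0 :=
    Finset.sum_comm
  calc ∑ a, ∑ b, f a b
      = ∑ a, ∑ b, ((if a < b then f a b else 0) + (if b < a then f a b else 0)) :=
        Finset.sum_congr rfl fun a _ => Finset.sum_congr rfl fun b _ => h1 a b
    _ = _ := by
        simp only [Finset.sum_add_distrib]
        rw [h2]
        simp only [← Finset.sum_add_distrib]
        refine Finset.sum_congr rfl fun a _ => Finset.sum_congr rfl fun b _ => ?_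
        split_ifs <;> simp

theorem crossing_one (p : ι → ZMod 2) {m : ℕ} (K : Fin m → ι) :
    crossing p (1 : Equiv.Perm (Fin m)) K = 0 := by
  unfold crossing
  refine Finset.sum_eq_zero fun a _ => Finset.sum_eq_zero fun b _ => ?_
  rw [if_neg]
  rintro ⟨h1, h2⟩
  exact absurd h1 (not_lt.mpr h2.le)

theorem crossing_mul (p : ι → ZMod 2) {m : ℕ} (σ τ : Equiv.Perm (Fin m)) (K : Fin m → ι) :
    crossing p (σ * τ) K = crossing p σ (K ∘ ⇑τ⁻¹) + crossing p τ K := by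
  have h : crossing p σ (K ∘ ⇑τ⁻¹) =
      ∑ a, ∑ b, if τ a < τ b ∧ σ (τ b) < σ (τ a) then p (K a) * p (K b) else 0 := by
    unfold crossing
    rw [← Equiv.sum_comp τ]
    refine Finset.sum_congr rfl fun a _ => ?_
    rw [← Equiv.sum_comp τ]
    simp
  rw [h]
  unfold crossing
  simp only [← Finset.sum_add_distrib]
  rw [sum_pairs _ (by simp), sum_pairs (fun a b =>
    (if τ a < τ b ∧ σ (τ b) < σ (τ a) then p (K a) * p (K b) else 0) +
      if a < b ∧ τ b < τ a then p (K a) * p (K b) else 0) (by simp)]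
  refine Finset.sum_congr rfl fun a _ => Finset.sum_congr rfl fun b _ => ?_
  by_cases hab : a < b
  · have e1 : τ a ≠ τ b := fun h => hab.ne (τ.injective h)
    have e2 : σ (τ a) ≠ σ (τ b) := fun h => e1 (σ.injective h)
    rw [mul_comm (p (K b)) (p (K a))]
    generalize p (K a) * p (K b) = x
    have hx := SuperMat.zmod_add_self x
    simp only [Equiv.Perm.coe_mul, Function.comp_apply, hab, hab.not_gt]
    rcases lt_or_gt_of_ne e1 with h1 | h1 <;> rcases lt_or_gt_of_ne e2 with h2 | h2 <;>
      simp [h1, h2, h1.not_gt, h2.not_gt, hx]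
  · simp [hab]

/-- The homomorphism `π_m` from the symmetric group to `(End V)^{⊗ m}`: `σ` moves the factor in
the place `a` to the place `σ a`, with the sign of the crossings of odd vectors.
See `superPerm_swap` for the images of the transpositions. -/
def superPerm (p : ι → ZMod 2) (m : ℕ) :
    Equiv.Perm (Fin m) →* Matrix (Fin m → ι) (Fin m → ι) ℂ where
  toFun σ := Matrix.of fun L K => if L = K ∘ ⇑σ⁻¹ then (ksign (crossing p σ K) : ℂ) else 0
  map_one' := by
    ext L K
    simp [Matrix.one_apply, crossing_one, ksign_zero]
  map_mul' σ τ := by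
    ext L K
    rw [Matrix.mul_apply, Finset.sum_eq_single (K ∘ ⇑τ⁻¹)]
    · have : K ∘ ⇑(σ * τ)⁻¹ = (K ∘ ⇑τ⁻¹) ∘ ⇑σ⁻¹ := by
        rw [mul_inv_rev]; rfl
      simp only [Matrix.of_apply]
      rw [this, crossing_mul, ksign_add]
      split_ifs <;> simp
    · intro J _ hJ
      simp only [Matrix.of_apply]
      rw [if_neg hJ, mul_zero]
    · simp

theorem place_single (p : ι → ZMod 2) {m : ℕ} (a : Fin m) (i j : ι) (L K : Fin m → ι) :
    place p a (Matrix.single i j (1 : ℂ)) L K =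
      if K a = j ∧ L = Function.update K a i then
        (ksign ((p i + p j) * ∑ b ∈ Finset.univ.filter (· < a), p (K b)) : ℂ) else 0 := by
  have hL : (L = Function.update K a i) ↔ L a = i ∧ ∀ b, b ≠ a → L b = K b :=
    Function.eq_update_iff
  simp only [place, Matrix.of_apply, Matrix.single_apply, hL]
  by_cases h1 : ∀ b, b ≠ a → L b = K b
  · by_cases h2 : L a = i
    · by_cases h3 : K a = j
      · simp [h2, h3]
      · simp [h3, Ne.symm h3]
    · simp [h2, Ne.symm h2]
  · simp [h1]

theorem crossing_swap (p : ι → ZMod 2) {m : ℕ} {a b : Fin m} (hab : a < b) (K : Fin m → ι) :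
    crossing p (Equiv.swap a b) K = p (K a) * p (K b) +
      (p (K a) + p (K b)) * ∑ c ∈ Finset.univ.filter (fun c => a < c ∧ c < b), p (K c) := by
  have key : ∀ x y, (if x < y ∧ Equiv.swap a b y < Equiv.swap a b x then p (K x) * p (K y) else 0)
      = (if x = a then if y = b then p (K a) * p (K b) else 0 else 0) +
        ((if x = a then if a < y ∧ y < b then p (K a) * p (K y) else 0 else 0) +
         (if y = b then if a < x ∧ x < b then p (K b) * p (K x) else 0 else 0)) := by
    intro x y
    rw [mul_comm (p (K b)) (p (K x))]
    simp only [Equiv.swap_apply_def]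
    by_cases hxa : x = a
    · subst hxa
      by_cases hyb : y = b
      · subst hyb
        simp [hab, hab.ne']
      · by_cases hyx : y = x
        · subst hyx; simp [hyb]
        · simp [hyb, hyx]
    · by_cases hxb : x = b
      · subst hxb
        by_cases hya : y = a
        · subst hya
          simp [hab.not_gt, hab.ne, hab.ne']
        · by_cases hyx : y = x
          · subst hyx; simp [hab.ne']
          · have : ¬ (x < y ∧ y < a) := fun h => absurd (h.1.trans h.2) hab.not_gt
            simp [hxa, hya, hyx, this]
      · by_cases hya : y = a
        · subst hya
          have : ¬ (x < y ∧ b < x) := fun h => absurd (h.2.trans h.1) hab.not_gt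
          simp [hxa, hxb, hab.ne, this]
        · by_cases hyb : y = b
          · subst hyb
            simp [hxa, hxb, hab.ne', and_comm]
          · have : ¬ (x < y ∧ y < x) := fun h => absurd h.1 h.2.not_gt
            simp [hxa, hxb, hya, hyb, this]
  unfold crossing
  simp only [key, Finset.sum_add_distrib]
  have e1 : ∑ x, ∑ y, (if x = a then if y = b then p (K a) * p (K b) else 0 else 0)
      = p (K a) * p (K b) := by
    rw [Finset.sum_eq_single a] <;> simp +contextual
  have e2 : ∑ x, ∑ y, (if x = a then if a < y ∧ y < b then p (K a) * p (K y) else 0 else 0)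
      = p (K a) * ∑ c ∈ Finset.univ.filter (fun c => a < c ∧ c < b), p (K c) := by
    rw [Finset.sum_eq_single a]
    · simp only [if_true, Finset.mul_sum, Finset.sum_filter, mul_ite, mul_zero]
    · intro x _ hx; simp [hx]
    · simp
  have e3 : ∑ x, ∑ y, (if y = b then if a < x ∧ x < b then p (K b) * p (K x) else 0 else 0)
      = p (K b) * ∑ c ∈ Finset.univ.filter (fun c => a < c ∧ c < b), p (K c) := by
    simp only [Finset.sum_ite_eq', Finset.mem_univ, if_true, Finset.mul_sum, Finset.sum_filter,
      mul_ite, mul_zero]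
  rw [e1, e2, e3]
  ring

theorem sum_lt_split {m : ℕ} {a b : Fin m} (hab : a < b) (f : Fin m → ZMod 2) :
    ∑ c ∈ Finset.univ.filter (· < b), f c = ∑ c ∈ Finset.univ.filter (· < a), f c +
      (f a + ∑ c ∈ Finset.univ.filter (fun c => a < c ∧ c < b), f c) := by
  have h : ∀ c, (if c < b then f c else 0) = (if c < a then f c else 0) +
      ((if c = a then f a else 0) + if a < c ∧ c < b then f c else 0) := by
    intro c
    rcases lt_trichotomy c a with h | h | h
    · simp [h, h.trans hab, h.ne, h.not_gt]
    · subst h; simp [hab]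
    · simp [h, h.ne', h.not_gt]
  simp only [Finset.sum_filter, h, Finset.sum_add_distrib, Finset.sum_ite_eq', Finset.mem_univ,
    if_true]

/-- `π_m` sends the transposition `(a b)` to `P_{ab}`. -/
theorem superPerm_swap (p : ι → ZMod 2) {m : ℕ} {a b : Fin m} (hab : a < b) :
    superPerm p m (Equiv.swap a b) = superP p a b := by
  ext L K
  have hK : Function.update (Function.update K b (K a)) a (K b) = K ∘ ⇑(Equiv.swap a b)⁻¹ := by
    funext c
    rw [Equiv.swap_inv, Function.comp_apply, Equiv.swap_apply_def]
    by_cases h1 : c = a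
    · subst h1; simp
    · by_cases h2 : c = b
      · subst h2; simp [h1]
      · simp [h1, h2]
  have hprod : ∀ i j, (place p a (Matrix.single i j (1 : ℂ)) *
      place p b (Matrix.single j i (1 : ℂ))) L K =
      if i = K b then if j = K a then if L = K ∘ ⇑(Equiv.swap a b)⁻¹ then
        (ksign ((p (K b) + p (K a)) * ∑ c ∈ Finset.univ.filter (· < a), p (K c)) : ℂ) *
        (ksign ((p (K a) + p (K b)) * ∑ c ∈ Finset.univ.filter (· < b), p (K c)) : ℂ)
        else 0 else 0 else 0 := by
    intro i j
    rw [Matrix.mul_apply, Finset.sum_eq_single (Function.update K b j)]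
    · simp only [place_single]
      by_cases hi : i = K b
      · subst hi
        by_cases hj : j = K a
        · subst hj
          have hs : ∑ c ∈ Finset.univ.filter (· < a), p (Function.update K b (K a) c) =
              ∑ c ∈ Finset.univ.filter (· < a), p (K c) := by
            refine Finset.sum_congr rfl fun c hc => ?_
            have : c ≠ b := ((Finset.mem_filter.mp hc).2.trans hab).ne
            simp [this]
          rw [hs, hK]
          simp [hab.ne]
          congr
        · simp [hab.ne, hj, Ne.symm hj]
      · simp [hi, Ne.symm hi]
    · intro J _ hJ
      simp [place_single, hJ]
    · simp
  simp only [superP, Matrix.sum_apply, Matrix.smul_apply, hprod]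
  rw [Finset.sum_eq_single (K b), Finset.sum_eq_single (K a)]
  · simp only [superPerm, MonoidHom.coe_mk, OneHom.coe_mk, Matrix.of_apply, if_true]
    split_ifs with hL
    · rw [crossing_swap p hab, sum_lt_split hab, zsmul_eq_mul, ← Int.cast_mul, ← Int.cast_mul,
        ← ksign_add, ← ksign_add]
      congr 2
      have h1 : p (K a) * p (K a) = p (K a) := by generalize p (K a) = x; revert x; decide
      clear hprod hK
      generalize ∑ c ∈ Finset.univ.filter (· < a), p (K c) = S at *
      generalize ∑ c ∈ Finset.univ.filter (fun c => a < c ∧ c < b), p (K c) = R at *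
      revert h1
      generalize p (K a) = x
      generalize p (K b) = y
      revert x y S R
      decide
    · simp
  · intro j _ hj; simp [hj]
  · simp
  · intro i _ hi; simp [hi]
  · simp

/-- The image `G^{(m)}` of the anti-symmetrizer `∑ sgn σ • σ` under `π_m`. -/
noncomputable def antisymmetrizer (p : ι → ZMod 2) (m : ℕ) :
    Matrix (Fin m → ι) (Fin m → ι) ℂ :=
  ∑ σ : Equiv.Perm (Fin m), (Equiv.Perm.sign σ : ℤ) • superPerm p m σ

/-- The image `H^{(m)}` of the symmetrizer `∑ σ` under `π_m`. -/
noncomputable def symmetrizer (p : ι → ZMod 2) (m : ℕ) :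
    Matrix (Fin m → ι) (Fin m → ι) ℂ :=
  ∑ σ : Equiv.Perm (Fin m), superPerm p m σ

theorem superP_even (p : ι → ZMod 2) (L K : Fin 2 → ι)
    (h : superP p (0 : Fin 2) 1 L K ≠ 0) : tpar p 2 L = tpar p 2 K := by
  rw [← superPerm_swap p (by decide)] at h
  simp only [superPerm, MonoidHom.coe_mk, OneHom.coe_mk, Matrix.of_apply] at h
  have hL : L = K ∘ ⇑(Equiv.swap (0 : Fin 2) 1)⁻¹ := by
    by_contra hne
    exact h (if_neg hne)
  subst hL
  simp [tpar, Fin.sum_univ_two, add_comm]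

theorem place_even {A : Type*} [Ring A] [Algebra ℂ A] [Superalgebra A] (p : ι → ZMod 2) {m : ℕ}
    (a : Fin m) (X : SuperMat p A) (hX : X.IsEven) :
    (SuperMat.of (place p a X) : SuperMat (tpar p m) A).IsEven := by
  intro L K
  simp only [SuperMat.of, place, Matrix.of_apply]
  split_ifs with h
  · have e : tpar p m L + tpar p m K = p (L a) + p (K a) := by
      have h2 : ∑ b ∈ Finset.univ.erase a, p (L b) = ∑ b ∈ Finset.univ.erase a, p (K b) :=
        Finset.sum_congr rfl fun b hb => by rw [h b (Finset.ne_of_mem_erase hb)]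
      unfold tpar
      rw [← Finset.add_sum_erase _ _ (Finset.mem_univ a),
        ← Finset.add_sum_erase (a := a) _ (fun b => p (K b)) (Finset.mem_univ a), h2]
      linear_combination SuperMat.zmod_add_self (∑ b ∈ Finset.univ.erase a, p (K b))
    rw [map_zsmul, hX, e, smul_comm]
  · simp

end Tensor

/-! ## The super Yangian -/

section Yangian

variable (M N : ℕ)

/-- The parity of the basis vector `e i` of `ℂ^{M|N}` (places are counted from `0`). -/
def par (i : Fin (M + N)) : ZMod 2 := if i.val < M then 0 else 1

/-- Labels of the generators: `⟨i, j, r⟩` stands for `t_{ij}^{(r+1)}`. -/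
structure YGen where
  row : Fin (M + N)
  col : Fin (M + N)
  deg : ℕ

noncomputable instance : Superalgebra (FreeAlgebra ℂ (YGen M N)) where
  parity := FreeAlgebra.lift ℂ fun g =>
    ksign (par M N g.row + par M N g.col) • FreeAlgebra.ι ℂ g
  parity_parity a := by
    have h : ((FreeAlgebra.lift ℂ fun g : YGen M N =>
        ksign (par M N g.row + par M N g.col) • FreeAlgebra.ι ℂ g).comp
        (FreeAlgebra.lift ℂ fun g : YGen M N =>
        ksign (par M N g.row + par M N g.col) • FreeAlgebra.ι ℂ g)) = AlgHom.id ℂ _ := by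
      ext g
      simp only [AlgHom.comp_apply, Function.comp_apply, FreeAlgebra.lift_ι_apply, map_zsmul,
        smul_smul, ksign_mul_self, one_smul, AlgHom.id_apply]
    exact DFunLike.congr_fun h a

/-- The matrices `(t_{ij}^{(r)})` over the free algebra, with `t_{ij}^{(0)} = δ i j`. -/
def freeT (r : ℕ) : SuperMat (par M N) (FreeAlgebra ℂ (YGen M N)) :=
  match r with
  | 0 => 1
  | r + 1 => fun i j => FreeAlgebra.ι ℂ ⟨i, j, r⟩

/-- `T_1^{(r)}` or `T_2^{(r)}` in `End V^{⊗ 2} ⊗ A`. -/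
def freeTAt (a : Fin 2) (r : ℕ) :
    SuperMat (tpar (par M N) 2) (FreeAlgebra ℂ (YGen M N)) :=
  SuperMat.of (place (par M N) a (freeT M N r))

/-- The operator `P ⊗ 1` in `End V^{⊗ 2} ⊗ A`. -/
noncomputable def freeP : SuperMat (tpar (par M N) 2) (FreeAlgebra ℂ (YGen M N)) :=
  SuperMat.ofOp (superP (par M N) 0 1)

/-- The coefficient of `u^{-r} v^{-s}` in `(u - v) R(u - v) T_1(u) T_2(v)`, where
`(u - v) R(u - v) = u - v - P`. -/
noncomputable def rttLeft (r s : ℕ) : SuperMat (tpar (par M N) 2) (FreeAlgebra ℂ (YGen M N)) :=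
  freeTAt M N 0 (r + 1) * freeTAt M N 1 s - freeTAt M N 0 r * freeTAt M N 1 (s + 1) -
    freeP M N * (freeTAt M N 0 r * freeTAt M N 1 s)

/-- The coefficient of `u^{-r} v^{-s}` in `(u - v) T_2(v) T_1(u) R(u - v)`. -/
noncomputable def rttRight (r s : ℕ) : SuperMat (tpar (par M N) 2) (FreeAlgebra ℂ (YGen M N)) :=
  freeTAt M N 1 s * freeTAt M N 0 (r + 1) - freeTAt M N 1 (s + 1) * freeTAt M N 0 r -
    freeTAt M N 1 s * freeTAt M N 0 r * freeP M N

/-- The defining relations `R(u - v) T_1(u) T_2(v) = T_2(v) T_1(u) R(u - v)`, entry by entry and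
coefficient by coefficient. (The coefficients of `u v^{-s}` and of `u^{-r} v` in the relation
multiplied by `u - v` agree trivially, because `T^{(0)} = 1`.) -/
inductive YRel : FreeAlgebra ℂ (YGen M N) → FreeAlgebra ℂ (YGen M N) → Prop
  | rtt (r s : ℕ) (L K : Fin 2 → Fin (M + N)) : YRel (rttLeft M N r s L K) (rttRight M N r s L K)

/-- The super Yangian `Y(gl_{M|N})`. -/
abbrev Yangian : Type := RingQuot (YRel M N)

theorem freeT_even (r : ℕ) : (freeT M N r).IsEven := by
  intro i j
  cases r with
  | zero =>
    simp only [freeT, SuperMat.one_apply]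
    split_ifs with h
    · subst h; simp [SuperMat.zmod_add_self, ksign_zero]
    · simp
  | succ r => exact FreeAlgebra.lift_ι_apply _ _

theorem freeTAt_even (a : Fin 2) (r : ℕ) : (freeTAt M N a r).IsEven :=
  place_even _ _ _ (freeT_even M N r)

theorem freeP_even : (freeP M N).IsEven :=
  SuperMat.isEven_ofOp fun L K h => superP_even _ L K h

theorem rttLeft_even (r s : ℕ) : (rttLeft M N r s).IsEven :=
  ((((freeTAt_even M N _ _).mul (freeTAt_even M N _ _)).sub
    ((freeTAt_even M N _ _).mul (freeTAt_even M N _ _))).sub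
    ((freeP_even M N).mul ((freeTAt_even M N _ _).mul (freeTAt_even M N _ _))))

theorem rttRight_even (r s : ℕ) : (rttRight M N r s).IsEven :=
  ((((freeTAt_even M N _ _).mul (freeTAt_even M N _ _)).sub
    ((freeTAt_even M N _ _).mul (freeTAt_even M N _ _))).sub
    (((freeTAt_even M N _ _).mul (freeTAt_even M N _ _)).mul (freeP_even M N)))

theorem parity_rel ⦃x y : FreeAlgebra ℂ (YGen M N)⦄ (h : YRel M N x y) :
    (RingQuot.mkAlgHom ℂ (YRel M N)).comp Superalgebra.parity x =
      (RingQuot.mkAlgHom ℂ (YRel M N)).comp Superalgebra.parity y := by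
  cases h with
  | rtt r s L K =>
    simp only [AlgHom.comp_apply]
    rw [rttLeft_even M N r s L K, rttRight_even M N r s L K, map_zsmul, map_zsmul,
      RingQuot.mkAlgHom_rel ℂ (YRel.rtt r s L K)]

/-- The grading of the super Yangian, `|t_{ij}^{(r)}| = |i| + |j|`. -/
noncomputable instance : Superalgebra (Yangian M N) where
  parity := RingQuot.liftAlgHom ℂ
    ⟨(RingQuot.mkAlgHom ℂ (YRel M N)).comp Superalgebra.parity, parity_rel M N⟩
  parity_parity a := by
    obtain ⟨x, rfl⟩ := RingQuot.mkAlgHom_surjective ℂ (YRel M N) a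
    simp [Superalgebra.parity_parity]

/-- The matrices `T^{(r)} = (t_{ij}^{(r)})` over the super Yangian, with `T^{(0)} = 1`. -/
noncomputable def coeffT (r : ℕ) : SuperMat (par M N) (Yangian M N) :=
  fun i j => RingQuot.mkAlgHom ℂ (YRel M N) (freeT M N r i j)

/-- The generator matrix `T(u)`. The variable `X` of power series stands for `u⁻¹`. -/
noncomputable def T : SuperMat (par M N) (Yangian M N)⟦X⟧ :=
  fun i j => PowerSeries.mk fun r => coeffT M N r i j

/-- `T(u)` is invertible, so that the next definition is the true inverse. -/
theorem isUnit_T : IsUnit (T M N) := by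
  have h : T M N = SuperMat.ofSeries (PowerSeries.mk (coeffT M N)) := by
    funext i j
    ext n
    exact (SuperMat.coeff_seriesFun (PowerSeries.mk (coeffT M N)) i j n ▸
      by rw [T, PowerSeries.coeff_mk, PowerSeries.coeff_mk])
  have h0 : coeffT M N 0 = 1 := by
    funext i j
    simp only [coeffT, freeT, SuperMat.one_apply]
    split_ifs <;> simp
  have hc : PowerSeries.constantCoeff (PowerSeries.mk (coeffT M N)) =
      ((1 : (SuperMat (par M N) (Yangian M N))ˣ) : SuperMat (par M N) (Yangian M N)) := by
    rw [← PowerSeries.coeff_zero_eq_constantCoeff_apply, PowerSeries.coeff_mk, h0, Units.val_one]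
  rw [h]
  refine IsUnit.map SuperMat.ofSeries ?_
  exact ⟨⟨_, _, PowerSeries.mul_invOfUnit _ 1 hc, PowerSeries.invOfUnit_mul _ 1 hc⟩, rfl⟩

/-- The inverse matrix `T(u)⁻¹ = (t̃_{ij}(u))`. -/
noncomputable def Tinv : SuperMat (par M N) (Yangian M N)⟦X⟧ := Ring.inverse (T M N)

/-- The matrix `T*(u) = (T(u)⁻¹)^t`. -/
noncomputable def Tstar : SuperMat (par M N) (Yangian M N)⟦X⟧ := (Tinv M N).transpose

/-- The series `f(u + c)`, expanded in `u⁻¹`, for a series `f(u) = ∑ f_r u^{-r}`: the sum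
`∑ (u + c)^{-r} f_r` with `(u + c)⁻¹ = u⁻¹ (1 + c u⁻¹)⁻¹`. Only `r ≤ n` contribute to the
coefficient of `u^{-n}`. -/
noncomputable def shift {A : Type*} [Ring A] [Algebra ℂ A] (c : ℂ) (f : A⟦X⟧) : A⟦X⟧ :=
  PowerSeries.mk fun n => ∑ r ∈ Finset.range (n + 1),
    PowerSeries.coeff n ((PowerSeries.X * (1 + PowerSeries.C c * PowerSeries.X)⁻¹) ^ r : ℂ⟦X⟧) •
      PowerSeries.coeff r f

/-- The quantum Berezinian
`∑_σ sgn σ t_{σ(1),1}(u+M-N-1) ⋯ t_{σ(M),M}(u-N) ×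
  ∑_τ sgn τ t̃_{M+1,M+τ(1)}(u-N) ⋯ t̃_{M+N,M+τ(N)}(u-1)`. -/
noncomputable def berezinian : (Yangian M N)⟦X⟧ :=
  (∑ σ : Equiv.Perm (Fin M), (Equiv.Perm.sign σ : ℤ) •
    (List.ofFn fun k : Fin M =>
      shift ((M : ℂ) - N - ((k : ℕ) + 1)) (T M N (Fin.castAdd N (σ k)) (Fin.castAdd N k))).prod) *
  (∑ τ : Equiv.Perm (Fin N), (Equiv.Perm.sign τ : ℤ) •
    (List.ofFn fun k : Fin N =>
      shift (-(N : ℂ) + (k : ℕ)) (Tinv M N (Fin.natAdd M k) (Fin.natAdd M (τ k)))).prod)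

/-! ## The fused operators -/

/-- The shift `w_i - u` of the spectral parameter; the place `a` is the index `i = a + 1`:
`w_i = u + M - N - i` for `i ≤ M`, and `w_i = u - M - N - 1 + i` for `i > M`. -/
noncomputable def wShift (a : Fin (M + N)) : ℂ :=
  if a.val < M then (M : ℂ) - N - ((a : ℕ) + 1) else -(M : ℂ) - N - 1 + ((a : ℕ) + 1)

/-- The projection `𝓘` of `V` onto its even part. -/
def projEven : Matrix (Fin (M + N)) (Fin (M + N)) ℂ :=
  Matrix.diagonal fun i => if par M N i = 0 then 1 else 0

/-- The projection `𝓙` of `V` onto its odd part. -/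
def projOdd : Matrix (Fin (M + N)) (Fin (M + N)) ℂ :=
  Matrix.diagonal fun i => if par M N i = 1 then 1 else 0

/-- The operator `ℑ = 𝓘_1 ⋯ 𝓘_M 𝓙_{M+1} ⋯ 𝓙_{M+N}` on `V^{⊗ (M+N)}`. -/
def projMixed : Matrix (Fin (M + N) → Fin (M + N)) (Fin (M + N) → Fin (M + N)) ℂ :=
  (List.ofFn fun a : Fin (M + N) =>
    place (par M N) a (if a.val < M then projEven M N else projOdd M N)).prod

/-- The operator `A^{(M|N)} = G^{(M)} ⊗ H^{(N)}` on `V^{⊗ (M+N)}`. -/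
noncomputable def fusionOp : Matrix (Fin (M + N) → Fin (M + N)) (Fin (M + N) → Fin (M + N)) ℂ :=
  tensorOp (par M N) (antisymmetrizer (par M N) M) (symmetrizer (par M N) N)

/-- The normalized operator `(M! N!)⁻¹ ℑ A^{(M|N)}`. -/
noncomputable def fusionProj : Matrix (Fin (M + N) → Fin (M + N)) (Fin (M + N) → Fin (M + N)) ℂ :=
  ((M.factorial : ℂ) * (N.factorial : ℂ))⁻¹ • (projMixed M N * fusionOp M N)

/-- The superalgebra `End V^{⊗ (M+N)} ⊗ Y(gl_{M|N})⟦u⁻¹⟧`. -/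
abbrev FusionAlg : Type := SuperMat (tpar (par M N) (M + N)) (Yangian M N)⟦X⟧

/-- The product `T_1(w_1) ⋯ T_M(w_M) T*_{M+1}(w_{M+1}) ⋯ T*_{M+N}(w_{M+N})`. -/
noncomputable def fusedT : FusionAlg M N :=
  (List.ofFn fun a : Fin (M + N) =>
    (SuperMat.of (place (par M N) a fun i j =>
      shift (wShift M N a) (if a.val < M then T M N i j else Tstar M N i j)) :
        FusionAlg M N)).prod

end Yangian

end SuperYangian

namespace SuperYangian

/-! ## Matrices over a superalgebra -/

namespace SuperMat

section Algebra

variable {ι : Type*} {p : ι → ZMod 2} {A : Type*}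

@[ext] theorem ext {X Y : SuperMat p A} (h : ∀ i j, X i j = Y i j) : X = Y :=
  Matrix.ext h

variable [Ring A] [Algebra ℂ A]

instance : Module ℂ (SuperMat p A) := inferInstanceAs (Module ℂ (Matrix ι ι A))

theorem smul_apply (c : ℂ) (X : SuperMat p A) (i j : ι) : (c • X) i j = c • X i j := rfl

variable [Fintype ι] [DecidableEq ι] [Superalgebra A]

noncomputable instance : Algebra ℂ (SuperMat p A) :=
  Algebra.ofModule
    (fun c X Y => by ext i j; simp only [mul_apply, smul_apply, map_smul, Finset.smul_sum,
      smul_mul_assoc])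
    (fun c X Y => by ext i j; simp only [mul_apply, smul_apply, Finset.smul_sum,
      mul_smul_comm])

end Algebra

section Operators

variable {ι : Type*} [Fintype ι] {p : ι → ZMod 2}
variable {A : Type*} [Ring A] [Algebra ℂ A] [Superalgebra A]

theorem ofOp_mul_apply (x : Matrix ι ι ℂ) (Y : SuperMat p A) (i k : ι) :
    (ofOp x * Y : SuperMat p A) i k = ∑ j, x i j • Y j k := by
  classical
  rw [mul_apply]
  refine Finset.sum_congr rfl fun j _ => ?_
  rw [ofOp, AlgHom.commutes, Algebra.smul_def]

theorem mul_ofOp_apply (X : SuperMat p A) (x : Matrix ι ι ℂ) (i k : ι) :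
    (X * ofOp x : SuperMat p A) i k = ∑ j, x j k • parityPow (p j + p k) (X i j) := by
  classical
  rw [mul_apply]
  refine Finset.sum_congr rfl fun j _ => ?_
  rw [ofOp, Algebra.smul_def, Algebra.commutes]

theorem mul_ofOp_diagonal_apply [DecidableEq ι] (X : SuperMat p A) (d : ι → ℂ) (i k : ι) :
    (X * ofOp (Matrix.diagonal d) : SuperMat p A) i k = d k • X i k := by
  rw [mul_ofOp_apply, Finset.sum_eq_single k]
  · rw [Matrix.diagonal_apply_eq, zmod_add_self, parityPow_zero]
  · intro j _ hj
    rw [Matrix.diagonal_apply_ne _ hj, zero_smul]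
  · simp

theorem ofOp_vecMulVec_mul_apply (v w : ι → ℂ) (X : SuperMat p A) (i k : ι) :
    (ofOp (Matrix.vecMulVec v w) * X : SuperMat p A) i k = v i • ∑ j, w j • X j k := by
  simp only [ofOp_mul_apply, Matrix.vecMulVec_apply, mul_smul, Finset.smul_sum]

theorem mul_ofCoeff_apply [DecidableEq ι] (X : SuperMat p A) (a : A) (i k : ι) :
    (X * ofCoeff a : SuperMat p A) i k = X i k * a := by
  rw [mul_apply, Finset.sum_eq_single k]
  · rw [ofCoeff, if_pos rfl, zmod_add_self, parityPow_zero]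
  · intro j _ hj
    rw [ofCoeff, if_neg hj, mul_zero]
  · simp

theorem ofOp_smul_mul_apply (z : ℂ) (x : Matrix ι ι ℂ) (X : SuperMat p A) (i k : ι) :
    (ofOp (z • x) * X : SuperMat p A) i k = z • (ofOp x * X : SuperMat p A) i k := by
  simp only [ofOp_mul_apply, Matrix.smul_apply, smul_eq_mul, mul_smul, Finset.smul_sum]

end Operators

end SuperMat

/-! ## Shifts of the spectral parameter -/

section Shift

/-- The series `(u + c)⁻¹`, expanded in `X = u⁻¹`. -/
noncomputable def shiftVar (c : ℂ) : ℂ⟦X⟧ :=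
  PowerSeries.X * (1 + PowerSeries.C c * PowerSeries.X)⁻¹

theorem shiftVar_mul_one_add (c : ℂ) :
    shiftVar c * (1 + PowerSeries.C c * PowerSeries.X) = PowerSeries.X := by
  rw [shiftVar, mul_assoc, PowerSeries.inv_mul_cancel _ (by simp), mul_one]

theorem sub_smul_shiftVar_mul_shiftVar (c d : ℂ) :
    (c - d) • (shiftVar c * shiftVar d) = shiftVar d - shiftVar c := by
  have hc := shiftVar_mul_one_add c
  have hd := shiftVar_mul_one_add d
  rw [PowerSeries.smul_eq_C_mul, map_sub]
  refine mul_left_cancel₀ (PowerSeries.X_ne_zero (R := ℂ)) ?_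
  linear_combination shiftVar d * hc - shiftVar c * hd

theorem coeff_shiftVar_pow_mul_pow_eq_zero (c d : ℂ) {n r s : ℕ} (h : n < r + s) :
    PowerSeries.coeff n (shiftVar c ^ r * shiftVar d ^ s) = 0 := by
  have hdvd (e : ℂ) (k : ℕ) : (PowerSeries.X ^ k : ℂ⟦X⟧) ∣ shiftVar e ^ k :=
    pow_dvd_pow_of_dvd (Dvd.intro _ rfl) k
  refine PowerSeries.X_pow_dvd_iff.mp ?_ n h
  rw [pow_add]
  exact mul_dvd_mul (hdvd c r) (hdvd d s)

variable {A : Type*} [Ring A] [Algebra ℂ A]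

theorem coeff_shift (c : ℂ) (f : A⟦X⟧) {n m : ℕ} (h : n < m) :
    PowerSeries.coeff n (shift c f) =
      ∑ r ∈ Finset.range m, PowerSeries.coeff n (shiftVar c ^ r) • PowerSeries.coeff r f := by
  rw [shift, PowerSeries.coeff_mk]
  refine Finset.sum_subset (Finset.range_mono h) fun r _ hr => ?_
  have hlt : n < r + 0 := by simpa [Nat.lt_succ_iff] using hr
  have hz := coeff_shiftVar_pow_mul_pow_eq_zero c c hlt
  rw [pow_zero, mul_one] at hz
  exact smul_eq_zero_of_left hz _

theorem constantCoeff_shift (c : ℂ) (f : A⟦X⟧) :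
    PowerSeries.constantCoeff (shift c f) = PowerSeries.constantCoeff f := by
  rw [← PowerSeries.coeff_zero_eq_constantCoeff_apply, coeff_shift c f Nat.zero_lt_one]
  simp

/-- The series `∑ (u + c)^{-r} (u + d)^{-s} g r s`, the value at `(u + c, u + d)` of the series in
two variables with coefficients `g`. As in `shift`, only `r, s ≤ n` contribute to the coefficient
of `u^{-n}`. -/
noncomputable def shift₂ (c d : ℂ) (g : ℕ → ℕ → A) : A⟦X⟧ :=
  PowerSeries.mk fun n => ∑ r ∈ Finset.range (n + 1), ∑ s ∈ Finset.range (n + 1),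
    PowerSeries.coeff n (shiftVar c ^ r * shiftVar d ^ s) • g r s

theorem coeff_shift₂ (c d : ℂ) (g : ℕ → ℕ → A) {n m : ℕ} (h : n < m) :
    PowerSeries.coeff n (shift₂ c d g) =
      ∑ r ∈ Finset.range m, ∑ s ∈ Finset.range m,
        PowerSeries.coeff n (shiftVar c ^ r * shiftVar d ^ s) • g r s := by
  have hzero (x : ℕ × ℕ) (hx : n < x.1 + x.2) :
      PowerSeries.coeff n (shiftVar c ^ x.1 * shiftVar d ^ x.2) • g x.1 x.2 = 0 := by
    rw [coeff_shiftVar_pow_mul_pow_eq_zero c d hx, zero_smul]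
  rw [shift₂, PowerSeries.coeff_mk, ← Finset.sum_product', ← Finset.sum_product']
  refine Finset.sum_subset (Finset.product_subset_product (Finset.range_mono h)
    (Finset.range_mono h)) fun x _ hx => hzero x ?_
  simp only [Finset.mem_product, Finset.mem_range] at hx
  omega

theorem shift₂_sub (c d : ℂ) (g h : ℕ → ℕ → A) :
    shift₂ c d (fun r s => g r s - h r s) = shift₂ c d g - shift₂ c d h := by
  ext n
  simp [shift₂, smul_sub]

theorem shift₂_swap (c d : ℂ) (g : ℕ → ℕ → A) :
    shift₂ d c (fun s r => g r s) = shift₂ c d g := by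
  ext n
  simp only [shift₂, PowerSeries.coeff_mk]
  rw [Finset.sum_comm]
  simp only [mul_comm (shiftVar d ^ _)]

theorem C_mul_shift₂ (c d : ℂ) (a : A) (g : ℕ → ℕ → A) :
    PowerSeries.C a * shift₂ c d g = shift₂ c d fun r s => a * g r s := by
  ext n
  simp [shift₂, Finset.mul_sum]

theorem shift₂_mul_C (c d : ℂ) (a : A) (g : ℕ → ℕ → A) :
    shift₂ c d g * PowerSeries.C a = shift₂ c d fun r s => g r s * a := by
  ext n
  simp [shift₂, Finset.sum_mul]

theorem shift_mul_shift (c d : ℂ) (f g : A⟦X⟧) :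
    shift c f * shift d g =
      shift₂ c d fun r s => PowerSeries.coeff r f * PowerSeries.coeff s g := by
  ext n
  have hterm : ∀ x ∈ Finset.HasAntidiagonal.antidiagonal n,
      PowerSeries.coeff x.1 (shift c f) * PowerSeries.coeff x.2 (shift d g) =
        ∑ r ∈ Finset.range (n + 1), ∑ s ∈ Finset.range (n + 1),
          (PowerSeries.coeff x.1 (shiftVar c ^ r) * PowerSeries.coeff x.2 (shiftVar d ^ s)) •
            (PowerSeries.coeff r f * PowerSeries.coeff s g) := fun x hx => by
    have hx := Finset.HasAntidiagonal.mem_antidiagonal.mp hx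
    rw [coeff_shift c f (by omega : x.1 < n + 1), coeff_shift d g (by omega : x.2 < n + 1),
      Finset.sum_mul_sum]
    simp only [smul_mul_smul_comm]
  rw [coeff_shift₂ c d _ n.lt_succ_self, PowerSeries.coeff_mul, Finset.sum_congr rfl hterm,
    Finset.sum_comm]
  refine Finset.sum_congr rfl fun r _ => ?_
  rw [Finset.sum_comm]
  refine Finset.sum_congr rfl fun s _ => ?_
  rw [PowerSeries.coeff_mul, Finset.sum_smul]

theorem shift_mul (c : ℂ) (f g : A⟦X⟧) : shift c (f * g) = shift c f * shift c g := by
  rw [shift_mul_shift]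
  ext n
  rw [coeff_shift c _ n.lt_succ_self, coeff_shift₂ c c _ n.lt_succ_self]
  let term (r s : ℕ) : A := PowerSeries.coeff n (shiftVar c ^ r * shiftVar c ^ s) •
    (PowerSeries.coeff r f * PowerSeries.coeff s g)
  have hdiag : ∀ k ∈ Finset.range (n + 1),
      PowerSeries.coeff n (shiftVar c ^ k) • PowerSeries.coeff k (f * g) =
        ∑ r ∈ Finset.range (k + 1), term r (k - r) := fun k _ => by
    rw [PowerSeries.coeff_mul, Finset.Nat.sum_antidiagonal_eq_sum_range_succ
      (fun i j => PowerSeries.coeff i f * PowerSeries.coeff j g), Finset.smul_sum]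
    refine Finset.sum_congr rfl fun r hr => ?_
    rw [← Nat.add_sub_cancel' (Finset.mem_range_succ_iff.mp hr), pow_add, Nat.add_sub_cancel_left]
  rw [Finset.sum_congr rfl hdiag, Finset.sum_range_diag_flip]
  refine Finset.sum_congr rfl fun r _ =>
    Finset.sum_subset (Finset.range_mono (by omega)) fun s _ hs => ?_
  have hlt : n < r + s := by rw [Finset.mem_range] at hs; omega
  simp only [term, coeff_shiftVar_pow_mul_pow_eq_zero c c hlt, zero_smul]

theorem shift_one (c : ℂ) : shift c (1 : A⟦X⟧) = 1 := by
  ext n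
  rw [coeff_shift c _ n.lt_succ_self, Finset.sum_eq_single 0]
  · simp [PowerSeries.coeff_one]
  · intro r _ hr
    simp [PowerSeries.coeff_one, hr]
  · simp

theorem sum_range_smul_succ {B : Type*} [AddCommGroup B] [Module ℂ B] (b : ℕ → ℂ) (h : ℕ → B)
    {m : ℕ} (hh : h 0 = 0) (hb : b m = 0) :
    ∑ s ∈ Finset.range m, b (s + 1) • h (s + 1) = ∑ s ∈ Finset.range m, b s • h s := by
  have hsucc := Finset.sum_range_succ' (fun s => b s • h s) m
  rwa [Finset.sum_range_succ, hh, hb, zero_smul, smul_zero, add_zero, add_zero, eq_comm] at hsucc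

theorem sum_range_sum_range_smul_succ_sub_succ {B : Type*} [AddCommGroup B] [Module ℂ B]
    {b : ℕ → ℕ → ℂ} {h : ℕ → ℕ → B} {m : ℕ} {z : ℂ} (h_left : ∀ s, h 0 s = 0)
    (h_right : ∀ r, h r 0 = 0) (b_left : ∀ s, b m s = 0) (b_right : ∀ r, b r m = 0)
    (hb : ∀ r s, b r (s + 1) - b (r + 1) s = z * b (r + 1) (s + 1)) :
    ∑ r ∈ Finset.range m, ∑ s ∈ Finset.range m, b r s • (h (r + 1) s - h r (s + 1)) =
      z • ∑ r ∈ Finset.range m, ∑ s ∈ Finset.range m, b r s • h r s := by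
  have hcol (r r' : ℕ) : ∑ s ∈ Finset.range m, b r' s • h r s =
      ∑ s ∈ Finset.range m, b r' (s + 1) • h r (s + 1) :=
    (sum_range_smul_succ (b r') (h r) (h_right r) (b_right r')).symm
  have hrow (s s' : ℕ) : ∑ r ∈ Finset.range m, b r s' • h r s =
      ∑ r ∈ Finset.range m, b (r + 1) s' • h (r + 1) s :=
    (sum_range_smul_succ (b · s') (h · s) (h_left s) (b_left s')).symm
  have hfirst : ∑ r ∈ Finset.range m, ∑ s ∈ Finset.range m, b r s • h (r + 1) s =
      ∑ r ∈ Finset.range m, ∑ s ∈ Finset.range m, b r (s + 1) • h (r + 1) (s + 1) := by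
    simp only [hcol]
  have hsecond : ∑ r ∈ Finset.range m, ∑ s ∈ Finset.range m, b r s • h r (s + 1) =
      ∑ r ∈ Finset.range m, ∑ s ∈ Finset.range m, b (r + 1) s • h (r + 1) (s + 1) := by
    rw [Finset.sum_comm, Finset.sum_comm (f := fun r s => b (r + 1) s • h (r + 1) (s + 1))]
    simp only [hrow]
  have hboth : ∑ r ∈ Finset.range m, ∑ s ∈ Finset.range m, b r s • h r s =
      ∑ r ∈ Finset.range m, ∑ s ∈ Finset.range m, b (r + 1) (s + 1) • h (r + 1) (s + 1) := by
    simp only [hcol]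
    rw [Finset.sum_comm, Finset.sum_comm (f := fun r s => b (r + 1) (s + 1) • h (r + 1) (s + 1))]
    simp only [hrow]
  simp only [smul_sub, Finset.sum_sub_distrib]
  rw [hfirst, hsecond, hboth]
  simp only [Finset.smul_sum, smul_smul, ← Finset.sum_sub_distrib, ← sub_smul, hb]

/-- The value at `(u + c, u + d)` of `(u - v) h(u, v)`: for `x = (u + c)⁻¹` and `y = (u + d)⁻¹`
one has `(c - d) x y = y - x`. -/
theorem shift₂_succ_sub_succ (c d : ℂ) {h : ℕ → ℕ → A} (h_left : ∀ s, h 0 s = 0)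
    (h_right : ∀ r, h r 0 = 0) :
    shift₂ c d (fun r s => h (r + 1) s - h r (s + 1)) = (c - d) • shift₂ c d h := by
  ext n
  rw [PowerSeries.coeff_smul, coeff_shift₂ c d _ n.lt_succ_self, coeff_shift₂ c d _ n.lt_succ_self]
  refine sum_range_sum_range_smul_succ_sub_succ h_left h_right
    (fun s => coeff_shiftVar_pow_mul_pow_eq_zero c d (by omega))
    (fun r => coeff_shiftVar_pow_mul_pow_eq_zero c d (by omega)) fun r s => ?_
  have hxy := sub_smul_shiftVar_mul_shiftVar c d
  rw [← map_sub, ← smul_eq_mul (a := c - d), ← PowerSeries.coeff_smul, PowerSeries.smul_eq_C_mul]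
  rw [PowerSeries.smul_eq_C_mul] at hxy
  congr 1
  linear_combination -shiftVar c ^ r * shiftVar d ^ s * hxy

end Shift

/-! ## Matrices in one tensor factor -/

namespace SuperMat

variable {ι : Type*} {p : ι → ZMod 2} {m : ℕ}

theorem tpar_add_tpar {a : Fin m} {L K : Fin m → ι} (h : ∀ b, b ≠ a → L b = K b) :
    tpar p m L + tpar p m K = p (L a) + p (K a) := by
  have hrest : ∑ b ∈ Finset.univ.erase a, p (L b) = ∑ b ∈ Finset.univ.erase a, p (K b) :=
    Finset.sum_congr rfl fun b hb => by rw [h b (Finset.ne_of_mem_erase hb)]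
  simp only [tpar, ← Finset.add_sum_erase _ _ (Finset.mem_univ a), hrest]
  linear_combination zmod_add_self (∑ b ∈ Finset.univ.erase a, p (K b))

variable [DecidableEq ι] {A : Type*} [Ring A]

/-- The element `X_a` of `End V^{⊗ m} ⊗ A`, for `X` in `End V ⊗ A`: the function underlying the
ring homomorphism `placed`. -/
def placedFun (a : Fin m) (X : SuperMat p A) : SuperMat (tpar p m) A := of (place p a X)

theorem placedFun_apply (a : Fin m) (X : SuperMat p A) (L K : Fin m → ι) :
    placedFun a X L K = if ∀ b, b ≠ a → L b = K b then
      ksign ((p (L a) + p (K a)) * ∑ b ∈ Finset.univ.filter (· < a), p (K b)) • X (L a) (K a)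
    else 0 := rfl

variable [Fintype ι] [Algebra ℂ A] [Superalgebra A]

theorem coeff_ofSeries (F : (SuperMat p A)⟦X⟧) (i j : ι) (n : ℕ) :
    PowerSeries.coeff n (ofSeries F i j) = PowerSeries.coeff n F i j :=
  coeff_seriesFun F i j n

theorem placedFun_mul (a : Fin m) (X Y : SuperMat p A) :
    placedFun a (X * Y) = placedFun a X * placedFun a Y := by
  ext L K
  simp only [mul_apply, placedFun_apply]
  rw [← Fintype.sum_of_injective (fun j => Function.update K a j) (Function.update_injective K a)
    (fun j => _) _ ?_ fun _ => rfl]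
  · split_ifs with h
    · rw [Finset.smul_sum]
      refine Finset.sum_congr rfl fun j _ => ?_
      have hK : ∀ b, b ≠ a → Function.update K a j b = K b := fun b hb =>
        Function.update_of_ne hb _ _
      have hsum : ∑ b ∈ Finset.univ.filter (· < a), p (Function.update K a j b) =
          ∑ b ∈ Finset.univ.filter (· < a), p (K b) :=
        Finset.sum_congr rfl fun b hb => by rw [hK b (Finset.mem_filter.mp hb).2.ne]
      rw [if_pos fun b hb => (h b hb).trans (hK b hb).symm, if_pos hK, tpar_add_tpar hK, hsum,
        Function.update_self, map_zsmul, smul_mul_smul_comm, ← ksign_add, ← add_mul]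
      congr 3
      linear_combination -zmod_add_self (p j)
    · refine (Finset.sum_eq_zero fun j _ => ?_).symm
      rw [if_neg fun h' => h fun b hb => (h' b hb).trans (Function.update_of_ne hb _ _), map_zero,
        zero_mul]
  · intro J hJ
    rw [if_neg (c := ∀ b, b ≠ a → J b = K b), mul_zero]
    exact fun h => hJ ⟨J a, (Function.eq_update_iff.mpr ⟨rfl, h⟩).symm⟩

/-- The homomorphism of rings `X ↦ X_a`. -/
def placed (a : Fin m) : SuperMat p A →+* SuperMat (tpar p m) A where
  toFun := placedFun a
  map_one' := by
    ext L K
    rw [placedFun_apply, one_apply, one_apply]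
    by_cases h : L = K
    · subst h
      simp [zmod_add_self, ksign_zero]
    · rw [if_neg h]
      split_ifs with hne ha
      · exact absurd (funext fun b => if hb : b = a then hb ▸ ha else hne b hb) h
      · exact smul_zero _
      · rfl
  map_mul' X Y := placedFun_mul a X Y
  map_zero' := by
    ext L K
    rw [placedFun_apply, zero_apply, zero_apply, smul_zero, ite_self]
  map_add' X Y := by
    ext L K
    rw [add_apply, placedFun_apply, placedFun_apply, placedFun_apply, add_apply, smul_add]
    split_ifs
    · rfl
    · exact (add_zero 0).symm

theorem placed_apply (a : Fin m) (X : SuperMat p A) (L K : Fin m → ι) :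
    placed a X L K = if ∀ b, b ≠ a → L b = K b then
      ksign ((p (L a) + p (K a)) * ∑ b ∈ Finset.univ.filter (· < a), p (K b)) • X (L a) (K a)
    else 0 := rfl

theorem prod_placed_apply_eq_zero (X : Fin m → SuperMat p A) {l : List (Fin m)}
    {J K : Fin m → ι} {b : Fin m} (hb : b ∉ l) (h : J b ≠ K b) :
    (l.map fun a => placed a (X a)).prod J K = 0 := by
  induction l generalizing J with
  | nil => rw [List.map_nil, List.prod_nil, one_apply, if_neg fun e => h (congrFun e b)]
  | cons a l ih =>
    rw [List.mem_cons, not_or] at hb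
    rw [List.map_cons, List.prod_cons, mul_apply]
    refine Finset.sum_eq_zero fun I _ => ?_
    by_cases hI : J b = I b
    · rw [ih hb.2 (hI ▸ h), mul_zero]
    · rw [placed_apply, if_neg fun e => hI (e b hb.1), map_zero, zero_mul]

theorem prod_placed_apply (X : Fin m → SuperMat p A) {l : List (Fin m)} (hl : l.Nodup)
    {J K : Fin m → ι} (hp : ∀ a, p (J a) = p (K a)) (hJK : ∀ b, b ∉ l → J b = K b) :
    (l.map fun a => placed a (X a)).prod J K = (l.map fun a => X a (J a) (K a)).prod := by
  induction l generalizing J with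
  | nil =>
    rw [List.map_nil, List.prod_nil, one_apply, if_pos (funext fun b => hJK b List.not_mem_nil)]
    rfl
  | cons a l ih =>
    rw [List.nodup_cons] at hl
    rw [List.map_cons, List.prod_cons, mul_apply, List.map_cons, List.prod_cons,
      Finset.sum_eq_single (Function.update J a (K a))]
    · have hJ : ∀ b, b ≠ a → Function.update J a (K a) b = J b := fun b hb =>
        Function.update_of_ne hb _ _
      have hp' : ∀ b, p (Function.update J a (K a) b) = p (K b) :=
        Function.forall_update_iff J (fun b x => p x = p (K b)) |>.mpr ⟨rfl, fun b _ => hp b⟩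
      have htpar : tpar p m (Function.update J a (K a)) = tpar p m K :=
        Finset.sum_congr rfl fun b _ => hp' b
      rw [ih hl.2 hp', placed_apply, if_pos fun b hb => (hJ b hb).symm, htpar, zmod_add_self,
        parityPow_zero, Function.update_self, hp, zmod_add_self, zero_mul, ksign_zero, one_smul,
        List.map_congr_left fun b hb => by rw [hJ b fun e => hl.1 (e ▸ hb)]]
      refine fun b hb => ?_
      by_cases hba : b = a
      · rw [hba, Function.update_self]
      · rw [hJ b hba, hJK b (by simp [hba, hb])]
    · intro I _ hI
      by_cases hJI : ∀ b, b ≠ a → J b = I b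
      · have ha : I a ≠ K a := fun ha =>
          hI (Function.eq_update_iff.mpr ⟨ha, fun b hb => (hJI b hb).symm⟩)
        rw [prod_placed_apply_eq_zero X hl.1 ha, mul_zero]
      · rw [placed_apply, if_neg hJI, map_zero, zero_mul]
    · simp

/-- The matrix `X(u + c)`. -/
noncomputable def shifted (c : ℂ) (X : SuperMat p A⟦X⟧) : SuperMat p A⟦X⟧ :=
  fun i j => shift c (X i j)

theorem ofSeries_shift_map_placed (c : ℂ) (a : Fin m) (F : (SuperMat p A)⟦X⟧) :
    ofSeries (shift c (PowerSeries.map (placed a) F)) = placed a (shifted c (ofSeries F)) := by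
  ext L K n
  rw [coeff_ofSeries, shift, PowerSeries.coeff_mk, sum_apply', placed_apply]
  simp only [smul_apply, PowerSeries.coeff_map, placed_apply, smul_ite, smul_zero]
  split_ifs
  · rw [map_zsmul, shifted, shift, PowerSeries.coeff_mk, Finset.smul_sum]
    simp only [coeff_ofSeries, smul_comm (ksign _)]
  · rw [Finset.sum_const_zero, map_zero]

theorem ofSeries_C_ofOp (x : Matrix ι ι ℂ) :
    ofSeries (PowerSeries.C (ofOp x : SuperMat p A)) = ofOp x := by
  ext i j n
  rw [coeff_ofSeries, PowerSeries.coeff_C, ofOp, PowerSeries.algebraMap_apply,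
    PowerSeries.coeff_C]
  split_ifs <;> rfl

theorem ofSeries_smul (c : ℂ) (F : (SuperMat p A)⟦X⟧) : ofSeries (c • F) = c • ofSeries F := by
  ext i j n
  rw [coeff_ofSeries, smul_apply, PowerSeries.coeff_smul, PowerSeries.coeff_smul, coeff_ofSeries,
    smul_apply]

end SuperMat

/-! ## The RTT relation -/

section RTT

variable {B : Type*} [Ring B] [Algebra ℂ B]

theorem smul_sub_eq_of_inverse {f g f' g' P : B} {z : ℂ}
    (hf : f * f' = 1) (hf' : f' * f = 1) (hg : g * g' = 1) (hg' : g' * g = 1)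
    (h : z • (f * g - g * f) = P * (f * g) - g * f * P) :
    z • (f' * g' - g' * f') = f' * g' * P - P * (g' * f') := by
  have hfg : f * g * (g' * f') = 1 := by
    rw [mul_assoc, ← mul_assoc g, hg, one_mul, hf]
  have hgf : f' * g' * (g * f) = 1 := by
    rw [mul_assoc, ← mul_assoc g', hg', one_mul, hf']
  calc z • (f' * g' - g' * f')
      = z • (f' * g' * (f * g * (g' * f')) - f' * g' * (g * f) * (g' * f')) := by
        rw [hfg, hgf, mul_one, one_mul]
    _ = f' * g' * (z • (f * g - g * f)) * (g' * f') := by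
        rw [mul_smul_comm, smul_mul_assoc, mul_sub, sub_mul, mul_assoc (f' * g') (f * g)]
    _ = f' * g' * P * (f * g * (g' * f')) - f' * g' * (g * f) * P * (g' * f') := by
        rw [h]
        noncomm_ring
    _ = f' * g' * P - P * (g' * f') := by
        rw [hfg, hgf, mul_one, one_mul]

theorem smul_shift_mul_shift_sub {f g : B⟦X⟧} {P : B} (hf : PowerSeries.coeff 0 f = 1)
    (hg : PowerSeries.coeff 0 g = 1)
    (h : ∀ r s, PowerSeries.coeff (r + 1) f * PowerSeries.coeff s g -
        PowerSeries.coeff r f * PowerSeries.coeff (s + 1) g -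
        P * (PowerSeries.coeff r f * PowerSeries.coeff s g) =
      PowerSeries.coeff s g * PowerSeries.coeff (r + 1) f -
        PowerSeries.coeff (s + 1) g * PowerSeries.coeff r f -
        PowerSeries.coeff s g * PowerSeries.coeff r f * P) (c d : ℂ) :
    (c - d) • (shift c f * shift d g - shift d g * shift c f) =
      PowerSeries.C P * (shift c f * shift d g) -
        shift d g * shift c f * PowerSeries.C P := by
  rw [shift_mul_shift, shift_mul_shift, ← shift₂_swap d c, C_mul_shift₂, shift₂_mul_C,
    ← shift₂_sub, ← shift₂_sub, ← shift₂_succ_sub_succ]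
  · congr! 3 with r s
    rw [← sub_eq_zero, ← sub_eq_zero.mpr (h r s)]
    abel
  · intro s
    simp [hf]
  · intro r
    simp [hg]

end RTT

section Entries

variable {ι : Type*} [Fintype ι] [DecidableEq ι] {p : ι → ZMod 2}

theorem superP_apply (L K : Fin 2 → ι) :
    superP p 0 1 L K = if L = ![K 1, K 0] then (ksign (p (K 0) * p (K 1)) : ℂ) else 0 := by
  have hK : K ∘ ⇑(Equiv.swap (0 : Fin 2) 1)⁻¹ = ![K 1, K 0] :=
    List.ofFn_inj.mp rfl
  have hlt : ∀ c : Fin 2, ¬ (0 < c ∧ c < 1) := by decide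
  rw [← superPerm_swap p (by decide)]
  simp only [superPerm, MonoidHom.coe_mk, OneHom.coe_mk, Matrix.of_apply, hK,
    crossing_swap p Fin.zero_lt_one, hlt, Finset.filter_false, Finset.sum_empty, mul_zero, add_zero]

namespace SuperMat

variable {A : Type*} [Ring A] [Algebra ℂ A] [Superalgebra A]

theorem ofOp_superP_mul_apply (Z : SuperMat (tpar p 2) A) (i k : ι) (K : Fin 2 → ι) :
    (ofOp (superP p 0 1) * Z : SuperMat (tpar p 2) A) ![i, k] K =
      ksign (p i * p k) • Z ![k, i] K := by
  have hswap (J : Fin 2 → ι) (h : ![i, k] = ![J 1, J 0]) : J = ![k, i] := by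
    rw [Matrix.vecCons_inj, Matrix.vecCons_inj] at h
    exact funext (Fin.forall_fin_two.mpr ⟨h.2.1.symm, h.1.symm⟩)
  have hP : superP p 0 1 ![i, k] ![k, i] = (ksign (p i * p k) : ℂ) := by
    rw [mul_comm]
    exact (superP_apply _ _).trans (if_pos rfl)
  rw [ofOp_mul_apply, Finset.sum_eq_single ![k, i]]
  · rw [hP, Int.cast_smul_eq_zsmul]
  · intro J _ hJ
    rw [superP_apply, if_neg fun h => hJ (hswap J h), zero_smul]
  · simp

theorem mul_ofOp_superP_apply (Z : SuperMat (tpar p 2) A) (L : Fin 2 → ι) (j l : ι) :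
    (Z * ofOp (superP p 0 1) : SuperMat (tpar p 2) A) L ![j, l] =
      ksign (p j * p l) • Z L ![l, j] := by
  have hP (J : Fin 2 → ι) : superP p 0 1 J ![j, l] =
      if J = ![l, j] then (ksign (p j * p l) : ℂ) else 0 := superP_apply J ![j, l]
  have htpar : tpar p 2 ![l, j] + tpar p 2 ![j, l] = 0 := by
    simp only [tpar, Fin.sum_univ_two, Matrix.cons_val_zero, Matrix.cons_val_one]
    linear_combination zmod_add_self (p j + p l)
  rw [mul_ofOp_apply, Finset.sum_eq_single ![l, j]]
  · rw [hP, if_pos rfl, Int.cast_smul_eq_zsmul, htpar, parityPow_zero]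
  · intro J _ hJ
    rw [hP, if_neg hJ, zero_smul]
  · simp

variable {q : ZMod 2} {i j k l : ι}

theorem placed_zero_mul_placed_one_apply (X Y : SuperMat p A) (hi : p i = q) (hj : p j = q)
    (hk : p k = q) (hl : p l = q) :
    (placed 0 X * placed 1 Y : SuperMat (tpar p 2) A) ![i, k] ![j, l] = X i j * Y k l := by
  simpa using prod_placed_apply ![X, Y] (l := [0, 1]) (by decide) (J := ![i, k]) (K := ![j, l])
    (Fin.forall_fin_two.mpr ⟨hi.trans hj.symm, hk.trans hl.symm⟩) (by simp [Fin.forall_fin_two])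

theorem placed_one_mul_placed_zero_apply (X Y : SuperMat p A) (hi : p i = q) (hj : p j = q)
    (hk : p k = q) (hl : p l = q) :
    (placed 1 Y * placed 0 X : SuperMat (tpar p 2) A) ![i, k] ![j, l] = Y k l * X i j := by
  simpa using prod_placed_apply ![X, Y] (l := [1, 0]) (by decide) (J := ![i, k]) (K := ![j, l])
    (Fin.forall_fin_two.mpr ⟨hi.trans hj.symm, hk.trans hl.symm⟩) (by simp [Fin.forall_fin_two])

theorem smul_entry_comm_of_rtt {X Y : SuperMat p A} {z : ℂ}
    (h : z • (placed (0 : Fin 2) X * placed 1 Y - placed 1 Y * placed 0 X) =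
      ofOp (superP p 0 1) * (placed 0 X * placed 1 Y) -
        placed 1 Y * placed 0 X * ofOp (superP p 0 1))
    (hi : p i = q) (hj : p j = q) (hk : p k = q) (hl : p l = q) :
    z • (X i j * Y k l - Y k l * X i j) = ksign q • (X k j * Y i l - Y k j * X i l) := by
  have hq : q * q = q := (by decide : ∀ q : ZMod 2, q * q = q) q
  have hentry := congrFun (congrFun h ![i, k]) ![j, l]
  rwa [smul_apply, sub_apply, sub_apply, ofOp_superP_mul_apply, mul_ofOp_superP_apply,
    placed_zero_mul_placed_one_apply _ _ hi hj hk hl,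
    placed_one_mul_placed_zero_apply _ _ hi hj hk hl,
    placed_zero_mul_placed_one_apply _ _ hk hj hi hl,
    placed_one_mul_placed_zero_apply _ _ hi hl hk hj, hi, hj, hk, hl, hq, ← smul_sub] at hentry

theorem smul_entry_comm_of_rtt_inverse {X Y : SuperMat p A} {z : ℂ}
    (h : z • (placed (0 : Fin 2) X * placed 1 Y - placed 1 Y * placed 0 X) =
      placed 0 X * placed 1 Y * ofOp (superP p 0 1) -
        ofOp (superP p 0 1) * (placed 1 Y * placed 0 X))
    (hi : p i = q) (hj : p j = q) (hk : p k = q) (hl : p l = q) :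
    z • (X i j * Y k l - Y k l * X i j) = ksign q • (X i l * Y k j - Y i l * X k j) := by
  have hq : q * q = q := (by decide : ∀ q : ZMod 2, q * q = q) q
  have hentry := congrFun (congrFun h ![i, k]) ![j, l]
  rwa [smul_apply, sub_apply, sub_apply, ofOp_superP_mul_apply, mul_ofOp_superP_apply,
    placed_zero_mul_placed_one_apply _ _ hi hj hk hl,
    placed_one_mul_placed_zero_apply _ _ hi hj hk hl,
    placed_zero_mul_placed_one_apply _ _ hi hl hk hj,
    placed_one_mul_placed_zero_apply _ _ hk hj hi hl, hi, hj, hk, hl, hq, ← smul_sub] at hentry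

variable {B : Type*} [Ring B] [Algebra ℂ B] [Superalgebra B]

/-- The homomorphism `1 ⊗ φ` for an even homomorphism `φ`. -/
def mapHom (p : ι → ZMod 2) (φ : A →ₐ[ℂ] B)
    (hφ : ∀ a, φ (Superalgebra.parity a) = Superalgebra.parity (φ a)) :
    SuperMat p A →+* SuperMat p B where
  toFun X i j := φ (X i j)
  map_one' := by
    ext i j
    rw [one_apply, one_apply, apply_ite φ, map_one, map_zero]
  map_mul' X Y := by
    have hφ' (q : ZMod 2) (a : A) : φ (parityPow q a) = parityPow q (φ a) := by
      unfold parityPow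
      split_ifs
      · rfl
      · exact hφ a
    ext i k
    change φ ((X * Y) i k) = ∑ j, parityPow (p j + p k) (φ (X i j)) * φ (Y j k)
    simp only [mul_apply, map_sum, map_mul, hφ']
  map_zero' := by
    ext i j
    rw [zero_apply, zero_apply, map_zero]
  map_add' X Y := by
    ext i j
    exact map_add φ _ _

theorem mapHom_apply (φ : A →ₐ[ℂ] B)
    (hφ : ∀ a, φ (Superalgebra.parity a) = Superalgebra.parity (φ a)) (X : SuperMat p A)
    (i j : ι) : mapHom p φ hφ X i j = φ (X i j) := rfl

end SuperMat

end Entries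

/-! ## The relations of the super Yangian -/

section Relations

variable (M N : ℕ)

theorem mkAlgHom_parity (a : FreeAlgebra ℂ (YGen M N)) :
    RingQuot.mkAlgHom ℂ (YRel M N) (Superalgebra.parity a) =
      Superalgebra.parity (RingQuot.mkAlgHom ℂ (YRel M N) a) := by
  change _ = RingQuot.liftAlgHom ℂ _ _
  rw [RingQuot.liftAlgHom_mkAlgHom_apply]
  rfl

theorem coeffT_zero : coeffT M N 0 = 1 := by
  ext i j
  rw [coeffT, freeT, SuperMat.one_apply, SuperMat.one_apply,
    apply_ite (RingQuot.mkAlgHom ℂ (YRel M N)), map_one, map_zero]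

theorem rtt_coeffT (r s : ℕ) :
    SuperMat.placed (0 : Fin 2) (coeffT M N (r + 1)) * SuperMat.placed 1 (coeffT M N s) -
      SuperMat.placed 0 (coeffT M N r) * SuperMat.placed 1 (coeffT M N (s + 1)) -
      SuperMat.ofOp (superP (par M N) 0 1) *
        (SuperMat.placed 0 (coeffT M N r) * SuperMat.placed 1 (coeffT M N s)) =
    SuperMat.placed 1 (coeffT M N s) * SuperMat.placed (0 : Fin 2) (coeffT M N (r + 1)) -
      SuperMat.placed 1 (coeffT M N (s + 1)) * SuperMat.placed 0 (coeffT M N r) -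
      SuperMat.placed 1 (coeffT M N s) * SuperMat.placed 0 (coeffT M N r) *
        SuperMat.ofOp (superP (par M N) 0 1) := by
  set π := SuperMat.mapHom (tpar (par M N) 2) (RingQuot.mkAlgHom ℂ (YRel M N))
    (mkAlgHom_parity M N)
  have hT (a : Fin 2) (r : ℕ) : π (freeTAt M N a r) = SuperMat.placed a (coeffT M N r) := by
    ext L K
    rw [SuperMat.mapHom_apply, SuperMat.placed_apply, coeffT]
    change RingQuot.mkAlgHom ℂ (YRel M N) (SuperMat.placed a (freeT M N r) L K) = _
    rw [SuperMat.placed_apply, apply_ite (RingQuot.mkAlgHom ℂ (YRel M N)), map_zsmul, map_zero]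
  have hP : π (freeP M N) = SuperMat.ofOp (superP (par M N) 0 1) := by
    ext L K
    exact AlgHom.commutes _ _
  have hrel : π (rttLeft M N r s) = π (rttRight M N r s) := by
    ext L K
    exact RingQuot.mkAlgHom_rel ℂ (YRel.rtt r s L K)
  simpa only [rttLeft, rttRight, map_sub, map_mul, hT, hP] using hrel

/-- The generator matrix `T(u)` as a series with coefficients in `End V ⊗ Y`. -/
noncomputable def Tseries : (SuperMat (par M N) (Yangian M N))⟦X⟧ :=
  PowerSeries.mk (coeffT M N)

theorem ofSeries_Tseries : SuperMat.ofSeries (Tseries M N) = T M N := by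
  ext i j n
  rw [SuperMat.coeff_ofSeries, Tseries, T, PowerSeries.coeff_mk, PowerSeries.coeff_mk]

theorem constantCoeff_Tseries : PowerSeries.constantCoeff (Tseries M N) = 1 := by
  rw [← PowerSeries.coeff_zero_eq_constantCoeff_apply, Tseries, PowerSeries.coeff_mk, coeffT_zero]

theorem isUnit_Tseries : IsUnit (Tseries M N) :=
  ⟨⟨_, _, PowerSeries.mul_invOfUnit _ 1 (constantCoeff_Tseries M N),
    PowerSeries.invOfUnit_mul _ 1 (constantCoeff_Tseries M N)⟩, rfl⟩

theorem ofSeries_inverse_Tseries :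
    SuperMat.ofSeries (Ring.inverse (Tseries M N)) = Tinv M N := by
  obtain ⟨t, ht⟩ := isUnit_Tseries M N
  rw [Tinv, ← ofSeries_Tseries, ← ht, Ring.inverse_unit]
  exact (Ring.inverse_unit (Units.map (SuperMat.ofSeries (p := par M N)).toMonoidHom t)).symm

theorem placed_shifted_T_comm (c d : ℂ) :
    (c - d) • (SuperMat.placed (0 : Fin 2) (SuperMat.shifted c (T M N)) *
        SuperMat.placed 1 (SuperMat.shifted d (T M N)) -
      SuperMat.placed 1 (SuperMat.shifted d (T M N)) *
        SuperMat.placed 0 (SuperMat.shifted c (T M N))) =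
    SuperMat.ofOp (superP (par M N) 0 1) *
        (SuperMat.placed 0 (SuperMat.shifted c (T M N)) *
          SuperMat.placed 1 (SuperMat.shifted d (T M N))) -
      SuperMat.placed 1 (SuperMat.shifted d (T M N)) *
          SuperMat.placed 0 (SuperMat.shifted c (T M N)) *
        SuperMat.ofOp (superP (par M N) 0 1) := by
  let t (a : Fin 2) := PowerSeries.map (SuperMat.placed a) (Tseries M N)
  have hcoeff (a : Fin 2) (r : ℕ) :
      PowerSeries.coeff r (t a) = SuperMat.placed a (coeffT M N r) := by
    rw [PowerSeries.coeff_map, Tseries, PowerSeries.coeff_mk]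
  have hzero (a : Fin 2) : PowerSeries.coeff 0 (t a) = 1 := by
    rw [hcoeff, coeffT_zero, map_one]
  have hseries := congrArg SuperMat.ofSeries
    (smul_shift_mul_shift_sub (hzero 0) (hzero 1) (P := SuperMat.ofOp (superP (par M N) 0 1))
      (fun r s => by simp only [hcoeff]; exact rtt_coeffT M N r s) c d)
  simpa only [t, SuperMat.ofSeries_smul, map_sub, map_mul, SuperMat.ofSeries_C_ofOp,
    SuperMat.ofSeries_shift_map_placed, ofSeries_Tseries] using hseries

theorem placed_shifted_T_mul_placed_shifted_Tinv {m : ℕ} (a : Fin m) (c : ℂ) :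
    SuperMat.placed a (SuperMat.shifted c (T M N)) *
      SuperMat.placed a (SuperMat.shifted c (Tinv M N)) = 1 := by
  rw [← ofSeries_Tseries, ← ofSeries_inverse_Tseries, ← SuperMat.ofSeries_shift_map_placed,
    ← SuperMat.ofSeries_shift_map_placed, ← map_mul, ← shift_mul, ← map_mul,
    Ring.mul_inverse_cancel _ (isUnit_Tseries M N), map_one, shift_one, map_one]

theorem placed_shifted_Tinv_mul_placed_shifted_T {m : ℕ} (a : Fin m) (c : ℂ) :
    SuperMat.placed a (SuperMat.shifted c (Tinv M N)) *
      SuperMat.placed a (SuperMat.shifted c (T M N)) = 1 := by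
  rw [← ofSeries_Tseries, ← ofSeries_inverse_Tseries, ← SuperMat.ofSeries_shift_map_placed,
    ← SuperMat.ofSeries_shift_map_placed, ← map_mul, ← shift_mul, ← map_mul,
    Ring.inverse_mul_cancel _ (isUnit_Tseries M N), map_one, shift_one, map_one]

theorem placed_shifted_Tinv_comm (c d : ℂ) :
    (c - d) • (SuperMat.placed (0 : Fin 2) (SuperMat.shifted c (Tinv M N)) *
        SuperMat.placed 1 (SuperMat.shifted d (Tinv M N)) -
      SuperMat.placed 1 (SuperMat.shifted d (Tinv M N)) *
        SuperMat.placed 0 (SuperMat.shifted c (Tinv M N))) =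
    SuperMat.placed 0 (SuperMat.shifted c (Tinv M N)) *
          SuperMat.placed 1 (SuperMat.shifted d (Tinv M N)) *
        SuperMat.ofOp (superP (par M N) 0 1) -
      SuperMat.ofOp (superP (par M N) 0 1) *
        (SuperMat.placed 1 (SuperMat.shifted d (Tinv M N)) *
          SuperMat.placed 0 (SuperMat.shifted c (Tinv M N))) :=
  smul_sub_eq_of_inverse (placed_shifted_T_mul_placed_shifted_Tinv M N 0 c)
    (placed_shifted_Tinv_mul_placed_shifted_T M N 0 c)
    (placed_shifted_T_mul_placed_shifted_Tinv M N 1 d)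
    (placed_shifted_Tinv_mul_placed_shifted_T M N 1 d) (placed_shifted_T_comm M N c d)

variable {M N} {i j k l : Fin (M + N)} {c d : ℂ}

theorem shift_T_comm_of_even (hi : par M N i = 0) (hj : par M N j = 0) (hk : par M N k = 0)
    (hl : par M N l = 0) (hcd : c - d = 1) :
    shift c (T M N i j) * shift d (T M N k l) - shift d (T M N k l) * shift c (T M N i j) =
      shift c (T M N k j) * shift d (T M N i l) - shift d (T M N k j) * shift c (T M N i l) := by
  have h := SuperMat.smul_entry_comm_of_rtt (placed_shifted_T_comm M N c d) hi hj hk hl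
  rwa [hcd, one_smul, ksign_zero, one_smul] at h

theorem shift_Tinv_comm_of_odd (hi : par M N i = 1) (hj : par M N j = 1) (hk : par M N k = 1)
    (hl : par M N l = 1) (hcd : c - d = -1) :
    shift c (Tinv M N i j) * shift d (Tinv M N k l) -
        shift d (Tinv M N k l) * shift c (Tinv M N i j) =
      shift c (Tinv M N i l) * shift d (Tinv M N k j) -
        shift d (Tinv M N i l) * shift c (Tinv M N k j) := by
  have h := SuperMat.smul_entry_comm_of_rtt_inverse (placed_shifted_Tinv_comm M N c d) hi hj hk hl
  rwa [hcd, show ksign 1 = -1 from rfl, neg_smul, neg_smul, one_smul, one_smul, neg_inj] at h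

end Relations

/-! ## Signs of maps -/

section MapSign

variable {n : ℕ}

/-- The sign of a map that is a permutation, and zero for every other map: the sign with which an
alternating expression in `n` letters changes when its letters are substituted along the map. -/
def mapSign (K : Fin n → Fin n) : ℤ := ((1 : Matrix (Fin n) (Fin n) ℤ).submatrix K id).det

theorem mapSign_perm (σ : Equiv.Perm (Fin n)) : mapSign σ = Equiv.Perm.sign σ := by
  rw [mapSign, Matrix.det_permute, Matrix.det_one, mul_one, Int.cast_id]

theorem mapSign_id : mapSign (id : Fin n → Fin n) = 1 := by
  rw [mapSign, Matrix.submatrix_id_id, Matrix.det_one]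

theorem mapSign_eq_zero {K : Fin n → Fin n} (hK : ¬ Function.Injective K) : mapSign K = 0 := by
  obtain ⟨a, b, hab, hne⟩ := Function.not_injective_iff.mp hK
  exact Matrix.det_zero_of_row_eq hne (funext fun c => by rw [Matrix.submatrix_apply, hab]; rfl)

theorem mapSign_mul_mapSign (L K : Fin n → Fin n) :
    mapSign L * mapSign K =
      ∑ σ : Equiv.Perm (Fin n), if L ∘ σ = K then (Equiv.Perm.sign σ : ℤ) else 0 := by
  have hdet : mapSign L * mapSign K = ((1 : Matrix (Fin n) (Fin n) ℤ).submatrix L K).det := by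
    rw [mapSign, mapSign, ← Matrix.det_transpose (.submatrix _ K id), Matrix.transpose_submatrix,
      Matrix.transpose_one, ← Matrix.det_mul, ← Matrix.submatrix_mul _ _ L id K
        Function.bijective_id, mul_one]
  rw [hdet, Matrix.det_apply']
  refine Finset.sum_congr rfl fun σ _ => ?_
  simp only [Matrix.submatrix_apply, Matrix.one_apply, Finset.prod_boole, Finset.mem_univ,
    forall_const, funext_iff, Function.comp_apply, mul_ite, mul_one, mul_zero, Int.cast_id]

theorem eq_mapSign_smul {B : Type*} [AddCommGroup B] [IsAddTorsionFree B]
    {f : (Fin n → Fin n) → B}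
    (hf : ∀ K (σ : Equiv.Perm (Fin n)), f (K ∘ σ) = Equiv.Perm.sign σ • f K)
    (K : Fin n → Fin n) : f K = mapSign K • f id := by
  by_cases hK : Function.Injective K
  · obtain ⟨σ, rfl⟩ : ∃ σ : Equiv.Perm (Fin n), σ = K :=
      ⟨Equiv.ofBijective K (Finite.injective_iff_bijective.mp hK), rfl⟩
    rw [mapSign_perm, ← Function.id_comp σ, hf]
    rfl
  · rw [mapSign_eq_zero hK, zero_smul, ← self_eq_neg]
    obtain ⟨a, b, hab, hne⟩ := Function.not_injective_iff.mp hK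
    have hswap : K ∘ Equiv.swap a b = K := by
      rw [Equiv.comp_swap_eq_update, hab, Function.update_eq_self, ← hab, Function.update_eq_self]
    have h := hf K (Equiv.swap a b)
    rwa [hswap, Equiv.Perm.sign_swap hne, Units.neg_smul, one_smul] at h

end MapSign

/-! ## Column determinants of Manin pairs -/

section ColumnDet

variable {n : ℕ} {B : Type*}

/-- Two matrices `x`, `y` over a noncommutative ring whose minors `x i j * y k l - x k j * y i l`
are antisymmetric in the columns `j`, `l`. For `x = y` these are the Manin matrices, for which the
column determinant is a sensible notion; here the two factors may differ by a shift of `u`. -/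
def IsManinPair [Mul B] [Sub B] {ι : Type*} (x y : Matrix ι ι B) : Prop :=
  ∀ i j k l, x i j * y k l - x k j * y i l = x k l * y i j - x i l * y k j

theorem IsManinPair.of_comm [Ring B] {ι : Type*} {x y : Matrix ι ι B}
    (h : ∀ i j k l, x i j * y k l - y k l * x i j = x k j * y i l - y k j * x i l) :
    IsManinPair x y := fun i j k l => by
  have hjl := h i j k l
  have hlj := h i l k j
  rw [sub_eq_iff_eq_add] at hjl hlj
  rw [hjl, hlj]
  abel

theorem exists_prod_ofFn_eq_mul [Monoid B] (f : Fin (n + 1) → B) (a : Fin n) :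
    ∃ P S : B, ∀ g : Fin (n + 1) → B, (∀ b, b ≠ a.castSucc → b ≠ a.succ → g b = f b) →
      (List.ofFn g).prod = P * (g a.castSucc * g a.succ) * S := by
  induction n with
  | zero => exact a.elim0
  | succ n ih =>
    refine Fin.cases ?_ (fun a => ?_) a
    · refine ⟨1, (List.ofFn fun b : Fin n => f b.succ.succ).prod, fun g hg => ?_⟩
      have htail : (fun b : Fin n => g b.succ.succ) = fun b => f b.succ.succ :=
        funext fun b => hg _ (Fin.succ_ne_zero _)
          fun e => Fin.succ_ne_zero _ (Fin.succ_injective _ e)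
      rw [List.ofFn_succ, List.ofFn_succ, List.prod_cons, List.prod_cons, htail, one_mul,
        mul_assoc]
      rfl
    · obtain ⟨P, S, h⟩ := ih (fun b => f b.succ) a
      refine ⟨f 0 * P, S, fun g hg => ?_⟩
      have hhead : g 0 = f 0 := hg 0 (Fin.castSucc_succ a ▸ (Fin.succ_ne_zero _).symm)
        (Fin.succ_ne_zero _).symm
      have htail := h (fun b => g b.succ) fun b h1 h2 =>
        hg _ (fun e => h1 (Fin.succ_injective _ e)) fun e => h2 (Fin.succ_injective _ e)
      rw [List.ofFn_succ, List.prod_cons, htail, hhead]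
      simp only [mul_assoc, Fin.castSucc_succ]

variable [Ring B]

/-- The column determinant `∑ sgn σ F_1(σ(1), K(1)) ⋯ F_n(σ(n), K(n))` with a matrix `F_a` of its
own for each place `a`, on the columns selected by `K`. -/
def columnDet (F : Fin n → Matrix (Fin n) (Fin n) B) (K : Fin n → Fin n) : B :=
  ∑ σ : Equiv.Perm (Fin n), Equiv.Perm.sign σ • (List.ofFn fun a => F a (σ a) (K a)).prod

theorem columnDet_one : columnDet (fun _ => (1 : Matrix (Fin n) (Fin n) B)) id = 1 := by
  rw [columnDet, Finset.sum_eq_single 1]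
  · have hdiag : (fun a : Fin n => (1 : Matrix (Fin n) (Fin n) B) ((1 : Equiv.Perm (Fin n)) a)
        (id a)) = fun _ => 1 := funext Matrix.one_apply_eq
    rw [hdiag, List.ofFn_const, List.prod_replicate, one_pow, Equiv.Perm.sign_one, one_smul]
  · intro σ _ hσ
    obtain ⟨a, ha⟩ : ∃ a, σ a ≠ a := by simpa [Equiv.ext_iff] using hσ
    rw [List.prod_eq_zero, smul_zero]
    exact List.mem_ofFn.mpr ⟨a, Matrix.one_apply_ne ha⟩
  · simp

theorem map_columnDet {C : Type*} [Ring C] (φ : B →+* C) (F : Fin n → Matrix (Fin n) (Fin n) B)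
    (K : Fin n → Fin n) : φ (columnDet F K) = columnDet (fun a => (F a).map φ) K := by
  simp only [columnDet, Units.smul_def, map_sum, map_zsmul, map_list_prod, List.map_ofFn]
  rfl

theorem columnDet_comp_swap {F : Fin (n + 1) → Matrix (Fin (n + 1)) (Fin (n + 1)) B} {a : Fin n}
    (hF : IsManinPair (F a.castSucc) (F a.succ)) (K : Fin (n + 1) → Fin (n + 1)) :
    columnDet F (K ∘ Equiv.swap a.castSucc a.succ) = -columnDet F K := by
  set s := Equiv.swap a.castSucc a.succ
  have hne : a.castSucc ≠ a.succ := Fin.castSucc_lt_succ.ne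
  rw [eq_neg_iff_add_eq_zero, columnDet, columnDet, ← Finset.sum_add_distrib]
  -- the Manin relation cancels the terms of `σ` against those of `σ * s`
  refine Finset.sum_involution (fun σ _ => σ * s) (fun σ _ => ?_) (fun σ _ _ hσ => ?_)
    (fun σ _ => Finset.mem_univ _) fun σ _ => by rw [mul_assoc, Equiv.swap_mul_self, mul_one]
  · obtain ⟨P, S, h⟩ := exists_prod_ofFn_eq_mul (fun b => F b (σ b) (K b)) a
    have hs (b) (h1 : b ≠ a.castSucc) (h2 : b ≠ a.succ) : s b = b :=
      Equiv.swap_apply_of_ne_of_ne h1 h2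
    rw [h (fun b => F b (σ b) (K b)) fun _ _ _ => rfl,
      h (fun b => F b (σ b) ((K ∘ s) b)) fun b h1 h2 => by rw [Function.comp_apply, hs b h1 h2],
      h (fun b => F b ((σ * s) b) (K b)) fun b h1 h2 => by rw [Equiv.Perm.mul_apply, hs b h1 h2],
      h (fun b => F b ((σ * s) b) ((K ∘ s) b)) fun b h1 h2 => by
        rw [Function.comp_apply, Equiv.Perm.mul_apply, hs b h1 h2],
      Equiv.Perm.sign_mul, Equiv.Perm.sign_swap hne, mul_neg, mul_one, Units.neg_smul,
      Units.neg_smul, ← neg_add, ← sub_eq_add_neg, sub_eq_zero, ← smul_add, ← smul_add,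
      ← add_mul, ← add_mul, ← mul_add, ← mul_add]
    simp only [Function.comp_apply, Equiv.Perm.mul_apply, s, Equiv.swap_apply_left,
      Equiv.swap_apply_right]
    have hmanin := hF (σ a.castSucc) (K a.castSucc) (σ a.succ) (K a.succ)
    rw [sub_eq_iff_eq_add'] at hmanin
    rw [hmanin]
    abel_nf
  · rw [mul_eq_left, Equiv.swap_eq_one_iff] at hσ
    exact hne hσ

theorem columnDet_comp_perm {F : Fin n → Matrix (Fin n) (Fin n) B}
    (hF : ∀ a b : Fin n, a.val + 1 = b.val → IsManinPair (F a) (F b)) (K : Fin n → Fin n)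
    (ρ : Equiv.Perm (Fin n)) : columnDet F (K ∘ ρ) = Equiv.Perm.sign ρ • columnDet F K := by
  cases n with
  | zero => simp [Subsingleton.elim ρ 1]
  | succ n =>
    have hρ : ρ ∈ Submonoid.closure
        (Set.range fun i : Fin n => Equiv.swap i.castSucc i.succ) := by
      rw [Equiv.Perm.mclosure_swap_castSucc_succ]
      trivial
    induction hρ using Submonoid.closure_induction generalizing K with
    | mem x h =>
      obtain ⟨a, rfl⟩ := h
      rw [columnDet_comp_swap (hF _ _ (by simp)), Equiv.Perm.sign_swap Fin.castSucc_lt_succ.ne,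
        Units.neg_smul, one_smul]
    | one => simp
    | mul x y _ _ hx hy =>
      rw [Equiv.Perm.coe_mul, ← Function.comp_assoc, hy, hx, smul_smul, Equiv.Perm.sign_mul,
        mul_comm]

theorem columnDet_eq_mapSign_smul [IsAddTorsionFree B] {F : Fin n → Matrix (Fin n) (Fin n) B}
    (hF : ∀ a b : Fin n, a.val + 1 = b.val → IsManinPair (F a) (F b)) (K : Fin n → Fin n) :
    columnDet F K = mapSign K • columnDet F id :=
  eq_mapSign_smul (columnDet_comp_perm hF) K

end ColumnDet

/-! ## The operators `ℑ` and `A^{(M|N)}` -/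

section Symmetrizers

variable {ι : Type*} {p : ι → ZMod 2} {m : ℕ}

theorem ksign_crossing_of_even (σ : Equiv.Perm (Fin m)) {K : Fin m → ι} (hK : ∀ a, p (K a) = 0) :
    ksign (crossing p σ K) = 1 := by
  simp [crossing, hK, ksign_zero]

theorem ksign_crossing_swap_one {a b : Fin m} (hab : a ≠ b) :
    ksign (crossing id (Equiv.swap a b) 1) = -1 := by
  wlog h : a < b generalizing a b
  · rw [Equiv.swap_comm]
    exact this hab.symm (lt_of_le_of_ne (not_lt.mp h) hab.symm)
  have hpair : id ((1 : Fin m → ZMod 2) a) + id ((1 : Fin m → ZMod 2) b) = 0 :=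
    SuperMat.zmod_add_self 1
  rw [crossing_swap id h, hpair, zero_mul, add_zero]
  rfl

theorem ksign_crossing_one (σ : Equiv.Perm (Fin m)) :
    ksign (crossing id σ 1) = Equiv.Perm.sign σ := by
  induction σ using Equiv.Perm.swap_induction_on with
  | one => rw [crossing_one, ksign_zero, Equiv.Perm.sign_one, Units.val_one]
  | swap_mul σ a b hab ih =>
    rw [crossing_mul, ksign_add, ih, Pi.one_comp, ksign_crossing_swap_one hab,
      Equiv.Perm.sign_mul, Equiv.Perm.sign_swap hab, neg_one_mul, neg_one_mul, Units.val_neg]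

theorem ksign_crossing_of_odd (σ : Equiv.Perm (Fin m)) {K : Fin m → ι} (hK : ∀ a, p (K a) = 1) :
    ksign (crossing p σ K) = Equiv.Perm.sign σ := by
  rw [← ksign_crossing_one, ← show p ∘ K = 1 from funext hK]
  rfl

variable [Fintype ι] [DecidableEq ι]

theorem superPerm_apply (σ : Equiv.Perm (Fin m)) (L K : Fin m → ι) :
    superPerm p m σ L K = if L ∘ σ = K then (ksign (crossing p σ K) : ℂ) else 0 :=
  if_congr (eq_comm.trans ((Equiv.comp_symm_eq σ L K).trans eq_comm)) rfl rfl

theorem antisymmetrizer_apply (L K : Fin m → ι) :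
    antisymmetrizer p m L K = ∑ σ : Equiv.Perm (Fin m), if L ∘ σ = K then
      ((Equiv.Perm.sign σ : ℤ) : ℂ) * (ksign (crossing p σ K) : ℂ) else 0 := by
  rw [antisymmetrizer, Matrix.sum_apply]
  refine Finset.sum_congr rfl fun σ _ => ?_
  rw [Matrix.smul_apply, superPerm_apply, smul_ite, zsmul_eq_mul, smul_zero]

theorem symmetrizer_apply (L K : Fin m → ι) :
    symmetrizer p m L K = ∑ σ : Equiv.Perm (Fin m), if L ∘ σ = K then
      (ksign (crossing p σ K) : ℂ) else 0 := by
  simp only [symmetrizer, Matrix.sum_apply, superPerm_apply]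

theorem exists_comp_eq_of_antisymmetrizer_ne_zero {L K : Fin m → ι}
    (h : antisymmetrizer p m L K ≠ 0) : ∃ σ : Equiv.Perm (Fin m), L ∘ σ = K := by
  rw [antisymmetrizer_apply] at h
  obtain ⟨σ, -, hσ⟩ := Finset.exists_ne_zero_of_sum_ne_zero h
  exact ⟨σ, (ite_ne_right_iff.mp hσ).1⟩

theorem exists_comp_eq_of_symmetrizer_ne_zero {L K : Fin m → ι}
    (h : symmetrizer p m L K ≠ 0) : ∃ σ : Equiv.Perm (Fin m), L ∘ σ = K := by
  rw [symmetrizer_apply] at h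
  obtain ⟨σ, -, hσ⟩ := Finset.exists_ne_zero_of_sum_ne_zero h
  exact ⟨σ, (ite_ne_right_iff.mp hσ).1⟩

theorem antisymmetrizer_comp_of_even {f : Fin m → ι} (hf : Function.Injective f)
    (hp : ∀ a, p (f a) = 0) (L K : Fin m → Fin m) :
    antisymmetrizer p m (f ∘ L) (f ∘ K) = mapSign L * mapSign K := by
  rw [antisymmetrizer_apply, ← Int.cast_mul, mapSign_mul_mapSign, Int.cast_sum]
  refine Finset.sum_congr rfl fun σ _ => ?_
  rw [ksign_crossing_of_even σ (K := f ∘ K) fun _ => hp _, Int.cast_one, mul_one, Int.cast_ite,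
    Int.cast_zero, Function.comp_assoc]
  exact if_congr hf.comp_left.eq_iff rfl rfl

theorem symmetrizer_comp_of_odd {f : Fin m → ι} (hf : Function.Injective f)
    (hp : ∀ a, p (f a) = 1) (L K : Fin m → Fin m) :
    symmetrizer p m (f ∘ L) (f ∘ K) = mapSign L * mapSign K := by
  rw [symmetrizer_apply, ← Int.cast_mul, mapSign_mul_mapSign, Int.cast_sum]
  refine Finset.sum_congr rfl fun σ _ => ?_
  rw [ksign_crossing_of_odd σ (K := f ∘ K) fun _ => hp _, Int.cast_ite, Int.cast_zero,
    Function.comp_assoc]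
  exact if_congr hf.comp_left.eq_iff rfl rfl

end Symmetrizers

theorem rank_vecMulVec_eq_one {n k : Type*} [Fintype n] [Field k] {v w : n → k} (hv : v ≠ 0)
    (hw : w ≠ 0) : (Matrix.vecMulVec v w).rank = 1 := by
  classical
  refine le_antisymm (Matrix.rank_vecMulVec_le _ _) (Nat.one_le_iff_ne_zero.mpr fun h => ?_)
  rw [Matrix.rank, Submodule.finrank_eq_zero, LinearMap.range_eq_bot] at h
  exact Matrix.vecMulVec_ne_zero hv hw (Matrix.toLin'.map_eq_zero_iff.mp h)

theorem place_diagonal {ι : Type*} [DecidableEq ι] (p : ι → ZMod 2) {m : ℕ} (a : Fin m)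
    (d : ι → ℂ) : place p a (Matrix.diagonal d) = Matrix.diagonal fun K => d (K a) := by
  ext L K
  rw [place, Matrix.of_apply, Matrix.diagonal_apply, Matrix.diagonal_apply]
  by_cases h : L = K
  · subst h
    simp [SuperMat.zmod_add_self, ksign_zero]
  · rw [if_neg h]
    split_ifs with hLK ha
    · exact absurd (funext fun b => if hb : b = a then hb ▸ ha else hLK b hb) h
    · exact smul_zero _
    · rfl

section Mixed

variable {M N : ℕ}

/-- The multi-indices `K` for which `e K` lies in the image of `ℑ`: even in the first `M` places
and odd in the last `N`. -/
def IsMixed (K : Fin (M + N) → Fin (M + N)) : Prop :=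
  (∀ a : Fin M, par M N (K (Fin.castAdd N a)) = 0) ∧ ∀ b : Fin N, par M N (K (Fin.natAdd M b)) = 1

instance : DecidablePred (IsMixed (M := M) (N := N)) :=
  fun _ => inferInstanceAs (Decidable (_ ∧ _))

variable (M N) in
theorem projMixed_eq_diagonal :
    projMixed M N = Matrix.diagonal fun K => if IsMixed K then (1 : ℂ) else 0 := by
  have hplace (a : Fin (M + N)) :
      place (par M N) a (if a.val < M then projEven M N else projOdd M N) =
        Matrix.diagonalRingHom (Fin (M + N) → Fin (M + N)) ℂ fun K =>
          if (if a.val < M then par M N (K a) = 0 else par M N (K a) = 1) then 1 else 0 := by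
    split_ifs <;> exact place_diagonal _ _ _
  simp only [projMixed, hplace]
  rw [← Function.comp_def (Matrix.diagonalRingHom (Fin (M + N) → Fin (M + N)) ℂ),
    ← List.map_ofFn, ← map_list_prod, List.prod_ofFn]
  refine congrArg Matrix.diagonal (funext fun K => ?_)
  rw [Finset.prod_apply, Fin.prod_univ_add]
  simp only [Fin.val_castAdd, Fin.val_natAdd, Fin.is_lt, if_true, Finset.prod_boole,
    Finset.mem_univ, forall_const, not_lt_of_ge (Nat.le_add_right M _), if_false, IsMixed,
    ite_zero_mul_ite_zero, mul_one]
  congr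

theorem par_castAdd (a : Fin M) : par M N (Fin.castAdd N a) = 0 := by simp [par]

theorem par_natAdd (b : Fin N) : par M N (Fin.natAdd M b) = 1 := by simp [par]

/-- The multi-index with the even basis vectors `K₁` in the first `M` places and the odd basis
vectors `K₂` in the last `N`. -/
def mix (K₁ : Fin M → Fin M) (K₂ : Fin N → Fin N) : Fin (M + N) → Fin (M + N) :=
  Fin.append (Fin.castAdd N ∘ K₁) (Fin.natAdd M ∘ K₂)

theorem mix_castAdd (K₁ : Fin M → Fin M) (K₂ : Fin N → Fin N) (a : Fin M) :
    mix K₁ K₂ (Fin.castAdd N a) = Fin.castAdd N (K₁ a) := Fin.append_left _ _ _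

theorem mix_natAdd (K₁ : Fin M → Fin M) (K₂ : Fin N → Fin N) (b : Fin N) :
    mix K₁ K₂ (Fin.natAdd M b) = Fin.natAdd M (K₂ b) := Fin.append_right _ _ _

theorem isMixed_mix (K₁ : Fin M → Fin M) (K₂ : Fin N → Fin N) : IsMixed (mix K₁ K₂) :=
  ⟨fun a => by rw [mix_castAdd, par_castAdd], fun b => by rw [mix_natAdd, par_natAdd]⟩

theorem mix_inj {K₁ L₁ : Fin M → Fin M} {K₂ L₂ : Fin N → Fin N} :
    mix K₁ K₂ = mix L₁ L₂ ↔ K₁ = L₁ ∧ K₂ = L₂ := by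
  refine ⟨fun h => ⟨funext fun a => ?_, funext fun b => ?_⟩, fun ⟨h₁, h₂⟩ => h₁ ▸ h₂ ▸ rfl⟩
  · simpa only [mix_castAdd, Fin.castAdd_inj] using congrFun h (Fin.castAdd N a)
  · simpa only [mix_natAdd, Fin.natAdd_inj] using congrFun h (Fin.natAdd M b)

theorem IsMixed.exists_eq_mix {K : Fin (M + N) → Fin (M + N)} (h : IsMixed K) :
    ∃ K₁ K₂, K = mix K₁ K₂ := by
  have heven (a : Fin M) : (K (Fin.castAdd N a)).val < M := by
    by_contra hn
    have := h.1 a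
    rw [par, if_neg hn] at this
    exact one_ne_zero this
  have hodd (b : Fin N) : M ≤ (K (Fin.natAdd M b)).val := by
    by_contra hn
    have := h.2 b
    rw [par, if_pos (not_le.mp hn)] at this
    exact zero_ne_one this
  refine ⟨fun a => (K (Fin.castAdd N a)).castLT (heven a),
    fun b => ⟨K (Fin.natAdd M b) - M, by have := hodd b; omega⟩, funext fun c => ?_⟩
  refine Fin.addCases (fun a => ?_) (fun b => ?_) c
  · rw [mix_castAdd, Fin.castAdd_castLT]
  · rw [mix_natAdd]
    ext
    rw [Fin.val_natAdd, Nat.add_sub_cancel' (hodd b)]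

theorem fusionOp_mix_mix (L₁ K₁ : Fin M → Fin M) (L₂ K₂ : Fin N → Fin N) :
    fusionOp M N (mix L₁ L₂) (mix K₁ K₂) =
      (mapSign L₁ * mapSign K₁) * (mapSign L₂ * mapSign K₂) := by
  have htpar (J : Fin N → Fin N) : tpar (par M N) N (fun b => Fin.natAdd M (J b)) = N := by
    simp [tpar, par_natAdd]
  rw [← antisymmetrizer_comp_of_even (Fin.castAdd_injective M N) par_castAdd,
    ← symmetrizer_comp_of_odd (Fin.natAdd_injective N M) par_natAdd, fusionOp, tensorOp,
    Matrix.of_apply]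
  simp only [mix_castAdd, mix_natAdd]
  rw [htpar, htpar, SuperMat.zmod_add_self, zero_mul, ksign_zero, one_smul]
  rfl

theorem isMixed_iff_of_fusionOp_ne_zero {L K : Fin (M + N) → Fin (M + N)}
    (h : fusionOp M N L K ≠ 0) : IsMixed L ↔ IsMixed K := by
  rw [fusionOp, tensorOp, Matrix.of_apply] at h
  have hmul := right_ne_zero_of_smul h
  obtain ⟨σ, hσ⟩ := exists_comp_eq_of_antisymmetrizer_ne_zero (left_ne_zero_of_mul hmul)
  obtain ⟨τ, hτ⟩ := exists_comp_eq_of_symmetrizer_ne_zero (right_ne_zero_of_mul hmul)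
  have heven (a) : K (Fin.castAdd N a) = L (Fin.castAdd N (σ a)) := (congrFun hσ a).symm
  have hodd (b) : K (Fin.natAdd M b) = L (Fin.natAdd M (τ b)) := (congrFun hτ b).symm
  simp only [IsMixed, heven, hodd]
  exact and_congr (σ.forall_congr_right (q := fun a => par M N (L (Fin.castAdd N a)) = 0)).symm
    (τ.forall_congr_right (q := fun b => par M N (L (Fin.natAdd M b)) = 1)).symm

variable (M N) in
/-- The vector `∑ sgn σ sgn τ e_{σ(1)} ⊗ ⋯ ⊗ e_{σ(M)} ⊗ e_{M+τ(1)} ⊗ ⋯ ⊗ e_{M+τ(N)}` that spans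
the image of `ℑ A^{(M|N)}`, by its coordinates. -/
noncomputable def fusionVec (K : Fin (M + N) → Fin (M + N)) : ℂ :=
  ∑ σ : Equiv.Perm (Fin M), ∑ τ : Equiv.Perm (Fin N),
    if mix σ τ = K then ((Equiv.Perm.sign σ : ℤ) : ℂ) * ((Equiv.Perm.sign τ : ℤ) : ℂ) else 0

theorem sum_fusionVec_smul {B : Type*} [AddCommGroup B] [Module ℂ B]
    (f : (Fin (M + N) → Fin (M + N)) → B) :
    ∑ J, fusionVec M N J • f J = ∑ σ : Equiv.Perm (Fin M), ∑ τ : Equiv.Perm (Fin N),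
      (((Equiv.Perm.sign σ : ℤ) : ℂ) * ((Equiv.Perm.sign τ : ℤ) : ℂ)) • f (mix σ τ) := by
  simp only [fusionVec, Finset.sum_smul]
  rw [Finset.sum_comm]
  refine Finset.sum_congr rfl fun σ _ => ?_
  rw [Finset.sum_comm]
  refine Finset.sum_congr rfl fun τ _ => ?_
  simp only [ite_smul, zero_smul, Finset.sum_ite_eq, Finset.mem_univ, if_true]

theorem fusionVec_mix (K₁ : Fin M → Fin M) (K₂ : Fin N → Fin N) :
    fusionVec M N (mix K₁ K₂) = mapSign K₁ * mapSign K₂ := by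
  have hsum {n : ℕ} (K : Fin n → Fin n) : mapSign K =
      ∑ σ : Equiv.Perm (Fin n), if ⇑σ = K then (Equiv.Perm.sign σ : ℤ) else 0 := by
    simpa only [mapSign_id, one_mul, Function.id_comp] using mapSign_mul_mapSign id K
  rw [fusionVec, hsum, hsum, Int.cast_sum, Int.cast_sum, Finset.sum_mul_sum]
  simp only [mix_inj, Int.cast_ite, Int.cast_zero, ite_zero_mul_ite_zero]

theorem fusionVec_mix_id : fusionVec M N (mix id id) = 1 := by
  rw [fusionVec_mix, mapSign_id, mapSign_id, Int.cast_one, mul_one]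

theorem fusionVec_eq_zero {K : Fin (M + N) → Fin (M + N)} (h : ¬ IsMixed K) :
    fusionVec M N K = 0 := by
  refine Finset.sum_eq_zero fun σ _ => Finset.sum_eq_zero fun τ _ => if_neg ?_
  rintro rfl
  exact h (isMixed_mix _ _)

variable (M N)

theorem fusionVec_dotProduct_self :
    fusionVec M N ⬝ᵥ fusionVec M N = (M.factorial : ℂ) * (N.factorial : ℂ) := by
  have hsq {n : ℕ} (σ : Equiv.Perm (Fin n)) :
      ((Equiv.Perm.sign σ : ℤ) : ℂ) * ((Equiv.Perm.sign σ : ℤ) : ℂ) = 1 := by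
    rw [← Int.cast_mul, ← Units.val_mul, Int.units_mul_self, Units.val_one, Int.cast_one]
  refine (sum_fusionVec_smul (fusionVec M N)).trans ?_
  simp only [fusionVec_mix, mapSign_perm, smul_eq_mul, mul_mul_mul_comm, hsq, Finset.sum_const,
    Finset.card_univ, Fintype.card_perm, Fintype.card_fin, nsmul_eq_mul, mul_one]

theorem projMixed_mul_fusionOp :
    projMixed M N * fusionOp M N = Matrix.vecMulVec (fusionVec M N) (fusionVec M N) := by
  ext L K
  rw [projMixed_eq_diagonal, Matrix.diagonal_mul, Matrix.vecMulVec_apply]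
  by_cases hL : IsMixed L
  · rw [if_pos hL, one_mul]
    by_cases hK : IsMixed K
    · obtain ⟨L₁, L₂, rfl⟩ := hL.exists_eq_mix
      obtain ⟨K₁, K₂, rfl⟩ := hK.exists_eq_mix
      rw [fusionOp_mix_mix, fusionVec_mix, fusionVec_mix, mul_mul_mul_comm]
    · rw [fusionVec_eq_zero hK, mul_zero]
      by_contra h
      exact hK ((isMixed_iff_of_fusionOp_ne_zero h).mp hL)
  · rw [if_neg hL, fusionVec_eq_zero hL, zero_mul, zero_mul]

theorem commute_fusionOp_projMixed : Commute (fusionOp M N) (projMixed M N) := by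
  ext L K
  rw [projMixed_eq_diagonal, Matrix.diagonal_mul, Matrix.mul_diagonal, mul_comm]
  by_cases h : fusionOp M N L K = 0
  · rw [h, mul_zero, mul_zero]
  · simp only [isMixed_iff_of_fusionOp_ne_zero h]

theorem factorial_mul_factorial_ne_zero : (M.factorial : ℂ) * (N.factorial : ℂ) ≠ 0 :=
  mul_ne_zero (Nat.cast_ne_zero.mpr M.factorial_ne_zero) (Nat.cast_ne_zero.mpr N.factorial_ne_zero)

theorem isIdempotentElem_fusionProj : IsIdempotentElem (fusionProj M N) := by
  rw [IsIdempotentElem, fusionProj, projMixed_mul_fusionOp, Matrix.smul_mul, Matrix.mul_smul,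
    Matrix.vecMulVec_mul_vecMulVec, fusionVec_dotProduct_self, Matrix.vecMulVec_smul,
    inv_smul_smul₀ (factorial_mul_factorial_ne_zero M N)]

theorem rank_fusionOp_mul_projMixed : (fusionOp M N * projMixed M N).rank = 1 := by
  rw [(commute_fusionOp_projMixed M N).eq, projMixed_mul_fusionOp]
  have hv : fusionVec M N ≠ 0 := fun h =>
    one_ne_zero (fusionVec_mix_id.symm.trans (congrFun h (mix id id)))
  exact rank_vecMulVec_eq_one hv hv

end Mixed

/-! ## The fusion identity -/

section Fusion

variable (M N : ℕ)

/-- The matrices `t_{ij}(w_a)`, `i, j ≤ M`, in the even factor of the Berezinian. -/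
noncomputable def evenFactor (a : Fin M) : Matrix (Fin M) (Fin M) (Yangian M N)⟦X⟧ :=
  fun i j => shift ((M : ℂ) - N - ((a : ℕ) + 1)) (T M N (Fin.castAdd N i) (Fin.castAdd N j))

/-- The matrices `t*_{M+i,M+j}(w_{M+b})`, `i, j ≤ N`, in the odd factor of the Berezinian; the
signs in the definition of `T*` are trivial here. -/
noncomputable def oddFactor (b : Fin N) : Matrix (Fin N) (Fin N) (Yangian M N)⟦X⟧ :=
  fun i j => shift (-(N : ℂ) + (b : ℕ)) (Tinv M N (Fin.natAdd M j) (Fin.natAdd M i))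

theorem berezinian_eq_columnDet_mul_columnDet :
    berezinian M N = columnDet (evenFactor M N) id * columnDet (oddFactor M N) id := rfl

theorem isManinPair_evenFactor {a b : Fin M} (hab : a.val + 1 = b.val) :
    IsManinPair (evenFactor M N a) (evenFactor M N b) := by
  refine .of_comm fun i j k l => shift_T_comm_of_even (par_castAdd i) (par_castAdd j)
    (par_castAdd k) (par_castAdd l) ?_
  rw [← hab]
  push_cast
  ring

theorem isManinPair_oddFactor {a b : Fin N} (hab : a.val + 1 = b.val) :
    IsManinPair (oddFactor M N a) (oddFactor M N b) := by
  refine .of_comm fun i j k l => shift_Tinv_comm_of_odd (par_natAdd j) (par_natAdd i)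
    (par_natAdd l) (par_natAdd k) ?_
  rw [← hab]
  push_cast
  ring

variable {M N}

theorem Tstar_natAdd_natAdd (i j : Fin N) :
    Tstar M N (Fin.natAdd M i) (Fin.natAdd M j) = Tinv M N (Fin.natAdd M j) (Fin.natAdd M i) := by
  rw [Tstar, SuperMat.transpose, par_natAdd, par_natAdd]
  exact one_smul ℤ _

theorem fusedT_mix_mix (J₁ K₁ : Fin M → Fin M) (J₂ K₂ : Fin N → Fin N) :
    fusedT M N (mix J₁ J₂) (mix K₁ K₂) =
      (List.ofFn fun a => evenFactor M N a (J₁ a) (K₁ a)).prod *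
        (List.ofFn fun b => oddFactor M N b (J₂ b) (K₂ b)).prod := by
  have hpar (c : Fin (M + N)) : par M N (mix J₁ J₂ c) = par M N (mix K₁ K₂ c) := by
    refine Fin.addCases (fun a => ?_) (fun b => ?_) c
    · rw [mix_castAdd, mix_castAdd, par_castAdd, par_castAdd]
    · rw [mix_natAdd, mix_natAdd, par_natAdd, par_natAdd]
  have hprod := SuperMat.prod_placed_apply (p := par M N)
    (fun a i j => shift (wShift M N a) (if a.val < M then T M N i j else Tstar M N i j))
    (List.nodup_finRange _) hpar fun c hc => absurd (List.mem_finRange c) hc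
  rw [← List.ofFn_eq_map, ← List.ofFn_eq_map] at hprod
  refine hprod.trans ?_
  rw [← List.prod_append, ← List.ofFn_fin_append]
  refine congrArg (fun f => (List.ofFn f).prod) (funext fun c => ?_)
  refine Fin.addCases (fun a => ?_) (fun b => ?_) c
  · rw [Fin.append_left, mix_castAdd, mix_castAdd, if_pos (by simp), wShift, if_pos (by simp)]
    rfl
  · rw [Fin.append_right, mix_natAdd, mix_natAdd, if_neg (by simp), wShift, if_neg (by simp),
      Tstar_natAdd_natAdd, oddFactor, Fin.val_natAdd]
    congr 1
    push_cast
    ring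

theorem columnDet_mul_columnDet {m n : ℕ} {B : Type*} [Ring B] [Algebra ℂ B]
    (F : Fin m → Matrix (Fin m) (Fin m) B) (G : Fin n → Matrix (Fin n) (Fin n) B)
    (K₁ : Fin m → Fin m) (K₂ : Fin n → Fin n) :
    columnDet F K₁ * columnDet G K₂ =
      ∑ σ : Equiv.Perm (Fin m), ∑ τ : Equiv.Perm (Fin n),
        (((Equiv.Perm.sign σ : ℤ) : ℂ) * ((Equiv.Perm.sign τ : ℤ) : ℂ)) •
          ((List.ofFn fun a => F a (σ a) (K₁ a)).prod *
            (List.ofFn fun b => G b (τ b) (K₂ b)).prod) := by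
  simp only [columnDet, Finset.sum_mul_sum, Units.smul_def, ← Int.cast_smul_eq_zsmul ℂ,
    smul_mul_smul_comm]

theorem sum_fusionVec_smul_fusedT {K : Fin (M + N) → Fin (M + N)} (hK : IsMixed K) :
    ∑ J, fusionVec M N J • fusedT M N J K = fusionVec M N K • berezinian M N := by
  have : IsAddTorsionFree (Yangian M N)⟦X⟧ := .of_isTorsionFree ℂ _
  obtain ⟨K₁, K₂, rfl⟩ := hK.exists_eq_mix
  simp only [sum_fusionVec_smul, fusedT_mix_mix]
  rw [← columnDet_mul_columnDet, columnDet_eq_mapSign_smul fun _ _ => isManinPair_evenFactor M N,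
    columnDet_eq_mapSign_smul fun _ _ => isManinPair_oddFactor M N, fusionVec_mix,
    berezinian_eq_columnDet_mul_columnDet, ← Int.cast_smul_eq_zsmul ℂ, ← Int.cast_smul_eq_zsmul ℂ,
    smul_mul_smul_comm]

variable (M N)

theorem mul_ofOp_projMixed_apply (X : FusionAlg M N) (L K : Fin (M + N) → Fin (M + N)) :
    (X * SuperMat.ofOp (projMixed M N) : FusionAlg M N) L K = if IsMixed K then X L K else 0 := by
  rw [projMixed_eq_diagonal, SuperMat.mul_ofOp_diagonal_apply, ite_smul, one_smul, zero_smul]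

theorem ofOp_mul_ofCoeff_apply (D : (Yangian M N)⟦X⟧) (L K : Fin (M + N) → Fin (M + N)) :
    (SuperMat.ofOp (projMixed M N * fusionOp M N) * SuperMat.ofCoeff D : FusionAlg M N) L K =
      (fusionVec M N L * fusionVec M N K) • D := by
  rw [SuperMat.mul_ofCoeff_apply, projMixed_mul_fusionOp, SuperMat.ofOp, ← Algebra.smul_def,
    Matrix.vecMulVec_apply]

variable {M N} in
theorem ofOp_mul_fusedT_apply (L : Fin (M + N) → Fin (M + N)) {K : Fin (M + N) → Fin (M + N)}
    (hK : IsMixed K) :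
    (SuperMat.ofOp (projMixed M N * fusionOp M N) * fusedT M N : FusionAlg M N) L K =
      (fusionVec M N L * fusionVec M N K) • berezinian M N := by
  rw [projMixed_mul_fusionOp, SuperMat.ofOp_vecMulVec_mul_apply, sum_fusionVec_smul_fusedT hK,
    mul_smul]

theorem fusion_identity :
    (SuperMat.ofOp (projMixed M N * fusionOp M N) : FusionAlg M N) *
        SuperMat.ofCoeff (berezinian M N) * SuperMat.ofOp (projMixed M N) =
      SuperMat.ofOp (projMixed M N * fusionOp M N) * fusedT M N *
        SuperMat.ofOp (projMixed M N) := by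
  ext1 L K
  rw [mul_ofOp_projMixed_apply, mul_ofOp_projMixed_apply]
  exact ite_congr rfl (fun hK => by rw [ofOp_mul_ofCoeff_apply, ofOp_mul_fusedT_apply L hK])
    fun _ => rfl

theorem eq_berezinian_of_fusion_identity (D : (Yangian M N)⟦X⟧)
    (h : (SuperMat.ofOp (projMixed M N * fusionOp M N) : FusionAlg M N) *
        SuperMat.ofCoeff D * SuperMat.ofOp (projMixed M N) =
      SuperMat.ofOp (projMixed M N * fusionOp M N) * fusedT M N *
        SuperMat.ofOp (projMixed M N)) : D = berezinian M N := by
  have hentry := congrFun₂ h (mix id id) (mix id id)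
  rwa [mul_ofOp_projMixed_apply, mul_ofOp_projMixed_apply, if_pos (isMixed_mix _ _),
    if_pos (isMixed_mix _ _), ofOp_mul_ofCoeff_apply, ofOp_mul_fusedT_apply _ (isMixed_mix _ _),
    fusionVec_mix_id, mul_one, one_smul, one_smul] at hentry

/-! ## The constant term -/

theorem constantCoeff_T (i j : Fin (M + N)) :
    PowerSeries.constantCoeff (T M N i j) = if i = j then 1 else 0 := by
  rw [← PowerSeries.coeff_zero_eq_constantCoeff_apply, T, PowerSeries.coeff_mk, coeffT_zero,
    SuperMat.one_apply]

theorem constantCoeff_Tinv (i j : Fin (M + N)) :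
    PowerSeries.constantCoeff (Tinv M N i j) = if i = j then 1 else 0 := by
  have hmul := congrArg PowerSeries.constantCoeff
    (Ring.mul_inverse_cancel _ (isUnit_Tseries M N))
  rw [map_mul, constantCoeff_Tseries, one_mul, map_one] at hmul
  rw [← ofSeries_inverse_Tseries, ← PowerSeries.coeff_zero_eq_constantCoeff_apply,
    SuperMat.coeff_ofSeries, PowerSeries.coeff_zero_eq_constantCoeff_apply, hmul,
    SuperMat.one_apply]

theorem constantCoeff_berezinian : PowerSeries.constantCoeff (berezinian M N) = 1 := by
  have heven (a : Fin M) : (evenFactor M N a).map PowerSeries.constantCoeff = 1 := by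
    ext i j
    simp only [Matrix.map_apply, evenFactor, constantCoeff_shift, constantCoeff_T,
      Fin.castAdd_inj, Matrix.one_apply]
  have hodd (b : Fin N) : (oddFactor M N b).map PowerSeries.constantCoeff = 1 := by
    ext i j
    simp only [Matrix.map_apply, oddFactor, constantCoeff_shift, constantCoeff_Tinv,
      Fin.natAdd_inj, Matrix.one_apply, eq_comm]
  simp only [berezinian_eq_columnDet_mul_columnDet, map_mul, map_columnDet, heven, hodd,
    columnDet_one, mul_one]

/-! ## The supertrace formulas -/

theorem ksign_natCast (n : ℕ) : ksign (n : ZMod 2) = (-1) ^ n := by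
  induction n with
  | zero => exact ksign_zero
  | succ n ih =>
    rw [Nat.cast_succ, ksign_add, ih, pow_succ]
    rfl

variable {M N}

theorem IsMixed.ksign_tpar {K : Fin (M + N) → Fin (M + N)} (h : IsMixed K) :
    ksign (tpar (par M N) (M + N) K) = (-1) ^ N := by
  rw [← ksign_natCast, tpar, Fin.sum_univ_add]
  simp [h.1, h.2]

theorem eq_neg_one_pow_mul_str {A : Type*} [Ring A] [Algebra ℂ A] {b : A}
    {X : SuperMat (tpar (par M N) (M + N)) A}
    (hX : ∀ K, X K K = (((M.factorial : ℂ) * (N.factorial : ℂ))⁻¹ *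
      (fusionVec M N K * fusionVec M N K)) • b) : b = (-1) ^ N * X.str := by
  have hterm (K : Fin (M + N) → Fin (M + N)) : ksign (tpar (par M N) (M + N) K) • X K K =
      (-1 : ℤ) ^ N • (((M.factorial : ℂ) * (N.factorial : ℂ))⁻¹ *
        (fusionVec M N K * fusionVec M N K)) • b := by
    by_cases hK : IsMixed K
    · rw [hX, hK.ksign_tpar]
    · rw [hX, fusionVec_eq_zero hK, mul_zero, mul_zero, zero_smul, smul_zero, smul_zero]
  have hstr : X.str = (-1 : ℤ) ^ N • b := by
    rw [SuperMat.str, Finset.sum_congr rfl fun K _ => hterm K, ← Finset.smul_sum,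
      ← Finset.sum_smul, ← Finset.mul_sum, ← dotProduct, fusionVec_dotProduct_self,
      inv_mul_cancel₀ (factorial_mul_factorial_ne_zero M N), one_smul]
  rw [hstr, zsmul_eq_mul, Int.cast_pow, Int.cast_neg, Int.cast_one, ← mul_assoc, ← pow_add,
    Even.neg_one_pow ⟨N, rfl⟩, one_mul]

variable (M N)

theorem ofOp_fusionProj_mul_fusedT_apply_self (K : Fin (M + N) → Fin (M + N)) :
    (SuperMat.ofOp (fusionProj M N) * fusedT M N : FusionAlg M N) K K =
      (((M.factorial : ℂ) * (N.factorial : ℂ))⁻¹ * (fusionVec M N K * fusionVec M N K)) •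
        berezinian M N := by
  rw [fusionProj, SuperMat.ofOp_smul_mul_apply, mul_smul]
  by_cases hK : IsMixed K
  · rw [ofOp_mul_fusedT_apply K hK]
  · rw [projMixed_mul_fusionOp, SuperMat.ofOp_vecMulVec_mul_apply, fusionVec_eq_zero hK, zero_smul,
      zero_mul, zero_smul]

theorem berezinian_eq_str :
    berezinian M N = (-1) ^ N *
      ((SuperMat.ofOp (fusionProj M N) : FusionAlg M N) * fusedT M N).str :=
  eq_neg_one_pow_mul_str (ofOp_fusionProj_mul_fusedT_apply_self M N)

theorem berezinian_eq_str_projMixed :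
    berezinian M N = (-1) ^ N *
      ((SuperMat.ofOp (fusionProj M N) : FusionAlg M N) * fusedT M N *
        SuperMat.ofOp (projMixed M N)).str := by
  refine eq_neg_one_pow_mul_str fun K => ?_
  rw [mul_ofOp_projMixed_apply]
  by_cases hK : IsMixed K
  · rw [if_pos hK, ofOp_fusionProj_mul_fusedT_apply_self]
  · rw [if_neg hK, fusionVec_eq_zero hK, mul_zero, mul_zero, zero_smul]

end Fusion

end SuperYangian

theorem mainTheorem12 (M N : ℕ) :
    -- the normalized operator is a projection with one-dimensional image
    (SuperYangian.fusionProj M N * SuperYangian.fusionProj M N = SuperYangian.fusionProj M N ∧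
      (SuperYangian.fusionOp M N * SuperYangian.projMixed M N).rank = 1) ∧
    -- the Berezinian belongs to `1 + u⁻¹ Y⟦u⁻¹⟧`
    PowerSeries.constantCoeff (SuperYangian.berezinian M N) = 1 ∧
    -- the fusion identity
    ((SuperYangian.SuperMat.ofOp (SuperYangian.projMixed M N * SuperYangian.fusionOp M N) :
          SuperYangian.FusionAlg M N) *
        SuperYangian.SuperMat.ofCoeff (SuperYangian.berezinian M N) *
        SuperYangian.SuperMat.ofOp (SuperYangian.projMixed M N) =
      SuperYangian.SuperMat.ofOp (SuperYangian.projMixed M N * SuperYangian.fusionOp M N) *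
        SuperYangian.fusedT M N * SuperYangian.SuperMat.ofOp (SuperYangian.projMixed M N)) ∧
    -- the Berezinian is the only series that satisfies the fusion identity
    (∀ D : PowerSeries (SuperYangian.Yangian M N),
      (SuperYangian.SuperMat.ofOp (SuperYangian.projMixed M N * SuperYangian.fusionOp M N) :
          SuperYangian.FusionAlg M N) *
        SuperYangian.SuperMat.ofCoeff D *
        SuperYangian.SuperMat.ofOp (SuperYangian.projMixed M N) =
      SuperYangian.SuperMat.ofOp (SuperYangian.projMixed M N * SuperYangian.fusionOp M N) *
        SuperYangian.fusedT M N * SuperYangian.SuperMat.ofOp (SuperYangian.projMixed M N) →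
      D = SuperYangian.berezinian M N) ∧
    -- the supertrace formulas
    (SuperYangian.berezinian M N = (-1) ^ N *
      ((SuperYangian.SuperMat.ofOp (SuperYangian.fusionProj M N) : SuperYangian.FusionAlg M N) *
        SuperYangian.fusedT M N).str) ∧
    (SuperYangian.berezinian M N = (-1) ^ N *
      ((SuperYangian.SuperMat.ofOp (SuperYangian.fusionProj M N) : SuperYangian.FusionAlg M N) *
        SuperYangian.fusedT M N *
        SuperYangian.SuperMat.ofOp (SuperYangian.projMixed M N)).str) :=
  ⟨⟨SuperYangian.isIdempotentElem_fusionProj M N, SuperYangian.rank_fusionOp_mul_projMixed M N⟩,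
    SuperYangian.constantCoeff_berezinian M N, SuperYangian.fusion_identity M N,
    SuperYangian.eq_berezinian_of_fusion_identity M N, SuperYangian.berezinian_eq_str M N,
    SuperYangian.berezinian_eq_str_projMixed M N⟩
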